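/- Let $P_1,P_2,Q\ge 0$. Consider the state-dependent Gaussian multiple-access channel $Y_i=X_{1,i}+X_{2,i}+S_i+Z_i$, $i=1,\dots,n$, where $S_1,\dots,S_n$ are i.i.d. $\mathcal N(0,Q)$ (the state), $Z_1,\dots,Z_n$ are i.i.d. $\mathcal N(0,1)$ (the noise), and the state, the noise and the messages $M_1,M_2$ are independent, with $M_1$ and $M_2$ uniformly distributed on finite sets. Encoder 1 knows the whole state sequence in advance and sends $X_1^n=x_1^n(M_1,S^n)$; encoder 2 does not know the state and sends $X_2^n=x_2^n(M_2)$; they satisfy the average power constraints $\sum_{i=1}^n\mathbb E[X_{1,i}^2]\le nP_1$ and $\sum_{i=1}^n\mathbb E[X_{2,i}^2]\le nP_2$. The decoder estimates $(M_1,M_2)$ from $Y^n$ alone, and the error probability is $\mathbb P[(\hat M_1,\hat M_2)\ne(M_1,M_2)]$. Let logarithms be taken to an arbitrary fixed base $b>1$. A pair $(R_1,R_2)$ of nonnegative reals is achievable if there is a sequence of such codes, one for each blocklength $n$, with at least $b^{nR_1}$ and $b^{nR_2}$ messages respectively, whose error probability tends to $0$ as $n\to\infty$. The capacity region $\mathcal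 C(P_1,P_2,Q)$ (without degraded message sets) is the closure of the set of achievable pairs. Theorem. For every $(R_1,R_2)\in\mathcal C(P_1,P_2,Q)$ there is a $\rho\in[-1,0]$ such that $$R_1\le\tfrac12\log\bigl(1+P_1(1-\rho^2)\bigr),\qquad R_2\le\tfrac12\log(1+P_2),$$ $$R_1+R_2\le\tfrac12\log\Bigl(1+\frac{P_2}{1+P_1+Q+2\rho\sqrt{P_1Q}}\Bigr)+\tfrac12\log\bigl(1+P_1(1-\rho^2)\bigr).$$ -/

import Mathlib

open MeasureTheory ProbabilityTheory Filter Topology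
open scoped NNReal ENNReal

noncomputable section

/-- A block code of length `n` with message sets of sizes `k₁` and `k₂`: encoder 1 sees its message
and the whole state sequence, encoder 2 sees only its message, and the decoder sees only the
channel output. -/
structure DirtyMACCode (n k₁ k₂ : ℕ) where
  /-- the codeword `x₁ⁿ(m₁, sⁿ)` -/
  enc₁ : Fin k₁ → (Fin n → ℝ) → (Fin n → ℝ)
  measurable_enc₁ : ∀ m, Measurable (enc₁ m)
  /-- the codeword `x₂ⁿ(m₂)` -/
  enc₂ : Fin k₂ → (Fin n → ℝ)
  dec : (Fin n → ℝ) → Fin k₁ × Fin k₂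
  measurable_dec : Measurable dec

/-- Outcomes `(m₁, m₂, sⁿ, zⁿ)`: the two messages, the state sequence and the noise sequence. -/
abbrev DirtyMACOutcome (n k₁ k₂ : ℕ) : Type :=
  Fin k₁ × Fin k₂ × (Fin n → ℝ) × (Fin n → ℝ)

/-- The joint law of messages, state and noise: all independent, the messages uniform, the state
i.i.d. `N(0, Q)` and the noise i.i.d. `N(0, 1)`. -/
def dirtyMACLaw (n k₁ k₂ : ℕ) (Q : ℝ≥0) : Measure (DirtyMACOutcome n k₁ k₂) :=
  (uniformOn (Set.univ : Set (Fin k₁))).prod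
    ((uniformOn (Set.univ : Set (Fin k₂))).prod
      ((Measure.pi fun _ : Fin n => gaussianReal 0 Q).prod
        (Measure.pi fun _ : Fin n => gaussianReal 0 1)))

namespace DirtyMACCode

variable {n k₁ k₂ : ℕ} (c : DirtyMACCode n k₁ k₂)

/-- The input `X₁ⁿ = x₁ⁿ(M₁, Sⁿ)` of the state-cognitive user. -/
def X₁ (ω : DirtyMACOutcome n k₁ k₂) : Fin n → ℝ := c.enc₁ ω.1 ω.2.2.1

/-- The input `X₂ⁿ = x₂ⁿ(M₂)` of the non-cognitive user. -/
def X₂ (ω : DirtyMACOutcome n k₁ k₂) : Fin n → ℝ := c.enc₂ ω.2.1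

/-- The channel output `Yⁿ = X₁ⁿ + X₂ⁿ + Sⁿ + Zⁿ`. -/
def Y (ω : DirtyMACOutcome n k₁ k₂) : Fin n → ℝ := c.X₁ ω + c.X₂ ω + ω.2.2.1 + ω.2.2.2

/-- The average power constraints `∑ᵢ E[X₁ᵢ²] ≤ n P₁` and `∑ᵢ E[X₂ᵢ²] ≤ n P₂`; the expectations are
Lebesgue integrals of nonnegative functions, so a non-integrable square violates them. -/
def SatisfiesPower (P₁ P₂ Q : ℝ≥0) : Prop :=
  ∑ i, ∫⁻ ω, ENNReal.ofReal (c.X₁ ω i ^ 2) ∂(dirtyMACLaw n k₁ k₂ Q) ≤ (n : ℝ≥0∞) * P₁ ∧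
  ∑ i, ∫⁻ ω, ENNReal.ofReal (c.X₂ ω i ^ 2) ∂(dirtyMACLaw n k₁ k₂ Q) ≤ (n : ℝ≥0∞) * P₂

/-- The average probability of error `P[(M̂₁, M̂₂) ≠ (M₁, M₂)]`. -/
def errorProb (Q : ℝ≥0) : ℝ :=
  (dirtyMACLaw n k₁ k₂ Q).real {ω | c.dec (c.Y ω) ≠ (ω.1, ω.2.1)}

end DirtyMACCode

/-- Rate pairs (logarithms to base `b`) for which there is a sequence of codes, one for each
blocklength `n`, with at least `b ^ (n R₁)` and `b ^ (n R₂)` messages, satisfying the power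
constraints, with vanishing average probability of error. -/
def DirtyMACAchievable (b : ℝ) (P₁ P₂ Q : ℝ≥0) (R : ℝ × ℝ) : Prop :=
  0 ≤ R.1 ∧ 0 ≤ R.2 ∧
    ∃ (k₁ k₂ : ℕ → ℕ) (c : ∀ n, DirtyMACCode n (k₁ n) (k₂ n)),
      (∀ n : ℕ, b ^ ((n : ℝ) * R.1) ≤ (k₁ n : ℝ) ∧ b ^ ((n : ℝ) * R.2) ≤ (k₂ n : ℝ) ∧
        (c n).SatisfiesPower P₁ P₂ Q) ∧
      Tendsto (fun n => (c n).errorProb Q) atTop (𝓝 0)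

/-- The capacity region of the dirty MAC without degraded message sets: the closure of the set of
achievable rate pairs. -/
def dirtyMACCapacityRegion (b : ℝ) (P₁ P₂ Q : ℝ≥0) : Set (ℝ × ℝ) :=
  closure {R | DirtyMACAchievable b P₁ P₂ Q R}

end

/-! The converse is proved by changing measure at a fixed blocklength; no entropy or mutual
information appears. If `exp (-L)` is the density of a reference law under which decoding succeeds
with probability at most `1 / K`, then the true success probability times `log K` is at most `E[L] +
log 2` (`measureReal_mul_log_le`): data processing for relative entropy, with `E[L]` as the
divergence.

Three references are used, all Gaussian with the same parameters in every coordinate. For `R₁`, the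
output given `(m₂, s)` is centred at `x₂ + (1 + β) s`, where `β s` is the linear estimate of `X₁`
from the state. For `R₂`, the output given `(m₁, s)` is centred at `x₁ + s`. For the sum rate, the
output is independent of the messages, and the state is then drawn around its linear estimate from
`y - x₂`. Each log-ratio is quadratic and each variance dominates the mean residual power, so `E[L]`
is at most `n / 2` times the logarithm of a variance ratio.

All second moments needed are controlled by the powers and one number `C`, the average of `E[X₁ᵢ
Sᵢ]` over the block, so no single-letter optimisation or concavity argument is needed. With `V = 1 +
P₁ + Q + 2C` and `e = 1 + P₁ - C² / Q`, the sum-rate reference gives the ratio `(P₂ + V) * (e / V) =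
(1 + P₂ / V) * e`. Replacing `C` by `min C 0` only enlarges the bounds, whence `ρ ∈ [-1, 0]`. Since
`ρ` depends on the code, compactness of `[-1, 0]` supplies one `ρ` in the limit, and also handles
the closure. -/

/-! ### Gaussian changes of measure. -/

/-- A product of measures with densities has the product density. -/
theorem MeasureTheory.Measure.pi_withDensity {ι : Type*} [Fintype ι] {X : ι → Type*}
    [∀ i, MeasurableSpace (X i)] (μ : ∀ i, Measure (X i)) [∀ i, IsProbabilityMeasure (μ i)]
    (f : ∀ i, X i → ℝ≥0∞) (hf : ∀ i, Measurable (f i))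
    [∀ i, SigmaFinite ((μ i).withDensity (f i))] :
    (Measure.pi μ).withDensity (fun x => ∏ i, f i (x i)) =
      Measure.pi fun i => (μ i).withDensity (f i) := by
  symm
  refine Measure.pi_eq fun s hs => ?_
  rw [withDensity_apply _ (MeasurableSet.univ_pi hs),
    ← lintegral_indicator (MeasurableSet.univ_pi hs)]
  have hind : (Set.univ.pi s).indicator (fun x => ∏ i, f i (x i)) =
      fun x => ∏ i, ((s i).indicator (f i)) (x i) := by
    ext x
    by_cases hx : x ∈ Set.univ.pi s
    · rw [Set.indicator_of_mem hx]
      exact Finset.prod_congr rfl fun i _ =>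
        (Set.indicator_of_mem (hx i (Set.mem_univ i)) _).symm
    · rw [Set.indicator_of_notMem hx]
      simp only [Set.mem_univ_pi, not_forall] at hx
      obtain ⟨i, hi⟩ := hx
      exact (Finset.prod_eq_zero (Finset.mem_univ i) (Set.indicator_of_notMem hi _)).symm
  have hm : ∀ i, Measurable ((s i).indicator (f i)) := fun i => (hf i).indicator (hs i)
  rw [hind, lintegral_prod_eq_prod_lintegral_of_indepFun Finset.univ
    (fun i (x : ∀ i, X i) => (s i).indicator (f i) (x i))
    (iIndepFun_pi (X := fun i => (s i).indicator (f i)) fun i => (hm i).aemeasurable)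
    (fun i => (hm i).comp (measurable_pi_apply i))]
  refine Finset.prod_congr rfl fun i _ => ?_
  rw [(measurePreserving_eval μ i).lintegral_comp (hm i), lintegral_indicator (hs i),
    withDensity_apply _ (hs i)]

/-- Minus the logarithm, at `z`, of the density of `N(z - d, κ Q)` with respect to `N(0, Q)`. -/
noncomputable def gaussianLogRatio (κ Q : ℝ≥0) (d z : ℝ) : ℝ :=
  Real.log κ / 2 + d ^ 2 / (2 * (κ * Q)) - z ^ 2 / (2 * Q)

theorem measurable_gaussianLogRatio (κ Q : ℝ≥0) :
    Measurable (fun p : ℝ × ℝ => gaussianLogRatio κ Q p.1 p.2) := by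
  unfold gaussianLogRatio
  fun_prop

@[fun_prop]
theorem Measurable.gaussianLogRatio {α : Type*} [MeasurableSpace α] {κ Q : ℝ≥0} {f g : α → ℝ}
    (hf : Measurable f) (hg : Measurable g) :
    Measurable (fun x => gaussianLogRatio κ Q (f x) (g x)) :=
  (measurable_gaussianLogRatio κ Q).comp (hf.prodMk hg)

/-- Quotient of the two Gaussian densities. At `Q = 0` there are none, but division by zero makes
the quadratic terms vanish; `κ = 1` and `m = 0` then leave the Dirac mass unchanged. This lets the
degenerate state go through without a separate proof. -/
theorem gaussianReal_withDensity_exp_gaussianLogRatio (κ Q : ℝ≥0) (hκ : κ ≠ 0) (m : ℝ)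
    (h : Q = 0 → κ = 1 ∧ m = 0) :
    (gaussianReal 0 Q).withDensity
        (fun z => ENNReal.ofReal (Real.exp (-gaussianLogRatio κ Q (z - m) z))) =
      gaussianReal m (κ * Q) := by
  rcases eq_or_ne Q 0 with hQ | hQ
  · obtain ⟨rfl, rfl⟩ := h hQ
    subst hQ
    simp [gaussianLogRatio]
  · have hQ' : (0 : ℝ) < Q := by positivity
    have hκ' : (0 : ℝ) < κ := by positivity
    rw [gaussianReal_of_var_ne_zero _ hQ, gaussianReal_of_var_ne_zero _ (mul_ne_zero hκ hQ),
      ← withDensity_mul _ (measurable_gaussianPDF _ _) (by fun_prop)]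
    congr 1
    ext z
    simp only [Pi.mul_apply, gaussianPDF]
    rw [← ENNReal.ofReal_mul (gaussianPDFReal_nonneg _ _ _)]
    congr 1
    rw [gaussianPDFReal_def, gaussianPDFReal_def]
    simp only [gaussianLogRatio, NNReal.coe_mul, sub_zero]
    have e1 : Real.exp (-(Real.log κ / 2 + (z - m) ^ 2 / (2 * (κ * Q)) - z ^ 2 / (2 * Q))) =
        (√(κ : ℝ))⁻¹ * Real.exp (-(z - m) ^ 2 / (2 * (κ * Q))) * Real.exp (z ^ 2 / (2 * Q)) := by
      rw [Real.sqrt_eq_rpow, Real.rpow_def_of_pos hκ', ← Real.exp_neg, ← Real.exp_add,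
        ← Real.exp_add]
      congr 1
      ring
    have e2 : Real.exp (-z ^ 2 / (2 * Q)) * Real.exp (z ^ 2 / (2 * Q)) = 1 := by
      rw [← Real.exp_add, neg_div, neg_add_cancel, Real.exp_zero]
    have e3 : √(2 * Real.pi * (κ * Q)) = √(2 * Real.pi * Q) * √(κ : ℝ) := by
      rw [← Real.sqrt_mul (by positivity)]
      congr 1
      ring
    rw [e1, e3, mul_inv]
    linear_combination (√(2 * Real.pi * Q))⁻¹ * (√(κ : ℝ))⁻¹ *
      Real.exp (-(z - m) ^ 2 / (2 * (κ * Q))) * e2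

theorem pi_gaussianReal_withDensity_exp_gaussianLogRatio {ι : Type*} [Fintype ι] (κ Q : ℝ≥0)
    (hκ : κ ≠ 0) (m : ι → ℝ) (h : Q = 0 → κ = 1 ∧ m = 0) :
    (Measure.pi fun _ : ι => gaussianReal 0 Q).withDensity
        (fun z => ENNReal.ofReal (Real.exp (-∑ i, gaussianLogRatio κ Q (z i - m i) (z i)))) =
      Measure.pi fun i => gaussianReal (m i) (κ * Q) := by
  have h1 : ∀ i, (gaussianReal 0 Q).withDensity
      (fun z => ENNReal.ofReal (Real.exp (-gaussianLogRatio κ Q (z - m i) z))) =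
      gaussianReal (m i) (κ * Q) := fun i =>
    gaussianReal_withDensity_exp_gaussianLogRatio κ Q hκ (m i)
      fun hQ => ⟨(h hQ).1, congrFun (h hQ).2 i⟩
  have : ∀ i, SigmaFinite ((gaussianReal 0 Q).withDensity
      (fun z => ENNReal.ofReal (Real.exp (-gaussianLogRatio κ Q (z - m i) z)))) := fun i => by
    rw [h1]
    infer_instance
  have h2 := Measure.pi_withDensity (fun _ : ι => gaussianReal 0 Q)
    (fun i z => ENNReal.ofReal (Real.exp (-gaussianLogRatio κ Q (z - m i) z)))
    (fun i => by fun_prop)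
  simp only [h1] at h2
  rw [← h2]
  congr 1
  ext z
  rw [← Finset.sum_neg_distrib, Real.exp_sum,
    ENNReal.ofReal_prod_of_nonneg fun i _ => (Real.exp_pos _).le]

theorem lintegral_pi_gaussianReal_exp_gaussianLogRatio {ι : Type*} [Fintype ι] (κ Q : ℝ≥0)
    (hκ : κ ≠ 0) (m : ι → ℝ) (h : Q = 0 → κ = 1 ∧ m = 0) :
    ∫⁻ z, ENNReal.ofReal (Real.exp (-∑ i, gaussianLogRatio κ Q (z i - m i) (z i)))
      ∂(Measure.pi fun _ : ι => gaussianReal 0 Q) = 1 := by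
  rw [← setLIntegral_univ, ← withDensity_apply _ MeasurableSet.univ,
    pi_gaussianReal_withDensity_exp_gaussianLogRatio κ Q hκ m h]
  exact measure_univ

/-- The weight turns the noise into `N(u - w, κ I)`, and translating by the channel input `w`
recentres the output at `u`. The new output law no longer involves `w`. -/
theorem lintegral_shift_pi_gaussianReal {ι : Type*} [Fintype ι] (κ : ℝ≥0) (hκ : κ ≠ 0)
    (w u : ι → ℝ) (F : (ι → ℝ) → ℝ≥0∞) (hF : Measurable F) :
    ∫⁻ z, ENNReal.ofReal (Real.exp (-∑ i, gaussianLogRatio κ 1 (w i + z i - u i) (z i))) *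
        F (w + z) ∂(Measure.pi fun _ : ι => gaussianReal 0 1) =
      ∫⁻ y, F y ∂(Measure.pi fun i => gaussianReal (u i) κ) := by
  have h1 := pi_gaussianReal_withDensity_exp_gaussianLogRatio κ 1 hκ (u - w)
    (fun h => absurd h one_ne_zero)
  have h2 : ∀ z : ι → ℝ, ∀ i, w i + z i - u i = z i - (u - w) i := fun z i => by
    simp only [Pi.sub_apply]
    ring
  simp only [h2]
  have h0 := lintegral_withDensity_eq_lintegral_mul (Measure.pi fun _ : ι => gaussianReal 0 1)
    (f := fun z => ENNReal.ofReal
      (Real.exp (-∑ i, gaussianLogRatio κ 1 (z i - (u - w) i) (z i))))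
    (by fun_prop) (g := fun z => F (w + z)) (by fun_prop)
  simp only [Pi.mul_apply] at h0
  rw [← h0, h1]
  have h3 : (Measure.pi fun i => gaussianReal ((u - w) i) (κ * 1)).map (fun z => w + z) =
      Measure.pi fun i => gaussianReal (u i) κ := by
    have h4 := Measure.pi_map_pi (μ := fun i => gaussianReal ((u - w) i) (κ * 1))
      (f := fun i z => w i + z) (fun i => by fun_prop)
    simp only [gaussianReal_map_const_add, Pi.sub_apply, sub_add_cancel, mul_one] at h4
    simp only [Pi.sub_apply, mul_one]
    exact h4
  rw [← h3, lintegral_map hF (by fun_prop)]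

/-! ### Fano's inequality through a reference measure. -/

/-- A Fano-type inequality: `exp (-L)` is the density of a reference measure under which the
event `C` has probability at most `1 / K`. -/
theorem measureReal_mul_log_le {Ω : Type*} [MeasurableSpace Ω] (μ : Measure Ω)
    [IsProbabilityMeasure μ] (L : Ω → ℝ) (hLm : Measurable L) (hL : Integrable L μ)
    (C : Set Ω) (hC : MeasurableSet C) (K : ℕ) (hK : 1 ≤ K)
    (h1 : ∫⁻ ω, ENNReal.ofReal (Real.exp (-L ω)) ∂μ ≤ 1)
    (h2 : K * ∫⁻ ω, ENNReal.ofReal (Real.exp (-L ω)) * C.indicator 1 ω ∂μ ≤ 1) :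
    μ.real C * Real.log K ≤ ∫ ω, L ω ∂μ + Real.log 2 := by
  have hK0 : (0 : ℝ) < K := by exact_mod_cast hK
  -- `E = exp (-L) * (1 + K 1_C)`, whose integral is at most `2` by the two bounds on the reference.
  set E : Ω → ℝ := fun ω => Real.exp (-L ω) + K * (Real.exp (-L ω) * C.indicator 1 ω) with hE
  have hind : ∀ ω, 0 ≤ C.indicator (1 : Ω → ℝ) ω := fun ω =>
    Set.indicator_nonneg (fun _ _ => zero_le_one) ω
  have hE0 : ∀ ω, 0 ≤ E ω := fun ω =>
    add_nonneg (Real.exp_pos _).le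
      (mul_nonneg hK0.le (mul_nonneg (Real.exp_pos _).le (hind ω)))
  have hindm : Measurable (C.indicator (1 : Ω → ℝ)) := measurable_one.indicator hC
  have hEm : Measurable E := by fun_prop
  have hEl : ∫⁻ ω, ENNReal.ofReal (E ω) ∂μ ≤ 2 := by
    have : ∀ ω, ENNReal.ofReal (E ω) = ENNReal.ofReal (Real.exp (-L ω)) +
        K * (ENNReal.ofReal (Real.exp (-L ω)) * C.indicator 1 ω) := fun ω => by
      rw [hE, ENNReal.ofReal_add (Real.exp_pos _).le
        (mul_nonneg hK0.le (mul_nonneg (Real.exp_pos _).le (hind ω))),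
        ENNReal.ofReal_mul hK0.le, ENNReal.ofReal_mul (Real.exp_pos _).le, ENNReal.ofReal_natCast]
      congr 3
      by_cases hω : ω ∈ C <;> simp [hω]
    simp only [this]
    rw [lintegral_add_left (by fun_prop), lintegral_const_mul' _ _ (by simp)]
    calc _ ≤ (1 : ℝ≥0∞) + 1 := add_le_add h1 h2
      _ = 2 := one_add_one_eq_two
  have hEi : Integrable E μ := by
    refine ⟨hEm.aestronglyMeasurable, ?_⟩
    rw [hasFiniteIntegral_iff_ofReal (Eventually.of_forall hE0)]
    exact hEl.trans_lt (by simp)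
  have hEint : ∫ ω, E ω ∂μ ≤ 2 := by
    rw [integral_eq_lintegral_of_nonneg_ae (Eventually.of_forall hE0) hEm.aestronglyMeasurable]
    exact ENNReal.toReal_le_of_le_ofReal (by norm_num) (by simpa using hEl)
  -- This is `x + 1 ≤ exp x` at `x = -L + 1_C log K - log 2`. The shift by `log 2` makes the
  -- integral of `E / 2` at most `1`, cancelling the `-1`.
  have hpt : ∀ ω, C.indicator (1 : Ω → ℝ) ω * Real.log K ≤
      L ω + (Real.log 2 - 1) + E ω / 2 := fun ω => by
    have hexp : Real.exp (-L ω) * Real.exp (C.indicator (1 : Ω → ℝ) ω * Real.log K) ≤ E ω := by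
      by_cases hω : ω ∈ C
      · simp only [hE, Set.indicator_of_mem hω, Pi.one_apply, one_mul, mul_one, Real.exp_log hK0]
        have := Real.exp_pos (-L ω)
        linarith
      · simp [hE, hω]
    rw [← Real.exp_add] at hexp
    have h3 := Real.add_one_le_exp (-L ω + C.indicator (1 : Ω → ℝ) ω * Real.log K - Real.log 2)
    rw [Real.exp_sub, Real.exp_log two_pos] at h3
    linarith
  have hIi : Integrable (fun ω => C.indicator (1 : Ω → ℝ) ω * Real.log K) μ :=
    ((integrable_const (1 : ℝ)).indicator hC).mul_const _
  have h4 := integral_mono hIi ((hL.add (integrable_const _)).add (hEi.div_const 2)) hpt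
  have h5 : ∫ ω, C.indicator (1 : Ω → ℝ) ω * Real.log K ∂μ = μ.real C * Real.log K := by
    rw [integral_mul_const, integral_indicator_one hC]
  have h6 : ∫ ω, ((L + fun _ : Ω => Real.log 2 - 1) + fun ω => E ω / 2 : Ω → ℝ) ω ∂μ =
      ∫ ω, L ω ∂μ + (Real.log 2 - 1) + (∫ ω, E ω ∂μ) / 2 := by
    rw [integral_add' (hL.add (integrable_const _)) (hEi.div_const 2),
      integral_add' hL (integrable_const _), integral_div]
    simp
  have h7 : μ.real C * Real.log K ≤
      ∫ ω, L ω ∂μ + (Real.log 2 - 1) + (∫ ω, E ω ∂μ) / 2 := by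
    rw [← h5, ← h6]
    exact h4
  linarith

/-- If `Dᵢ` has total power at most `n κ Q` and `Wᵢ` total power `n Q`, the expected log-ratio is
at most `(n / 2) log κ`. -/
theorem integral_sum_gaussianLogRatio_le {Ω : Type*} [MeasurableSpace Ω] (μ : Measure Ω)
    [IsProbabilityMeasure μ] {n : ℕ} (κ Q : ℝ≥0) (hκ : κ ≠ 0) (D W : Fin n → Ω → ℝ)
    (hD : ∀ i, MemLp (D i) 2 μ) (hW : ∀ i, MemLp (W i) 2 μ)
    (hDp : ∑ i, ∫ ω, D i ω ^ 2 ∂μ ≤ n * (κ * Q)) (hWp : ∑ i, ∫ ω, W i ω ^ 2 ∂μ = n * Q) :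
    Integrable (fun ω => ∑ i, gaussianLogRatio κ Q (D i ω) (W i ω)) μ ∧
      ∫ ω, ∑ i, gaussianLogRatio κ Q (D i ω) (W i ω) ∂μ ≤ n / 2 * Real.log κ := by
  have hDi : ∀ i, Integrable (fun ω => D i ω ^ 2 / (2 * (κ * Q))) μ := fun i =>
    (hD i).integrable_sq.div_const _
  have hWi : ∀ i, Integrable (fun ω => W i ω ^ 2 / (2 * Q)) μ := fun i =>
    (hW i).integrable_sq.div_const _
  have hc : Integrable (fun _ : Ω => Real.log κ / 2) μ := integrable_const _
  have hi : ∀ i, Integrable (fun ω => gaussianLogRatio κ Q (D i ω) (W i ω)) μ := fun i =>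
    (hc.add (hDi i)).sub (hWi i)
  refine ⟨integrable_finsetSum _ fun i _ => hi i, ?_⟩
  have he : ∀ i, ∫ ω, gaussianLogRatio κ Q (D i ω) (W i ω) ∂μ = Real.log κ / 2 +
      (∫ ω, D i ω ^ 2 ∂μ) / (2 * (κ * Q)) - (∫ ω, W i ω ^ 2 ∂μ) / (2 * Q) := fun i => by
    unfold gaussianLogRatio
    have e1 : Integrable (fun ω => Real.log κ / 2 + D i ω ^ 2 / (2 * (κ * Q))) μ := hc.add (hDi i)
    rw [integral_sub e1 (hWi i), integral_add hc (hDi i), integral_const, integral_div, integral_div]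
    simp
  rw [integral_finsetSum _ fun i _ => hi i]
  simp only [he]
  rw [Finset.sum_sub_distrib, Finset.sum_add_distrib, ← Finset.sum_div, ← Finset.sum_div,
    ← Finset.sum_div, hWp]
  simp only [Finset.sum_const, Finset.card_univ, Fintype.card_fin, nsmul_eq_mul]
  -- For `Q = 0` both quotients are zero by convention and only the `log κ` terms remain. Otherwise
  -- the power of `D` contributes at most `n / 2`, which the power of `W` cancels.
  rcases eq_or_ne Q 0 with hQ | hQ
  · simp [hQ]
    apply le_of_eq
    ring
  · have hQ' : (0 : ℝ) < Q := by positivity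
    have hκ' : (0 : ℝ) < κ := by positivity
    have h1 : (∑ i, ∫ ω, D i ω ^ 2 ∂μ) / (2 * (κ * Q)) ≤ n / 2 := by
      rw [div_le_iff₀ (by positivity)]
      linarith
    have h2 : (n * Q : ℝ) / (2 * Q) = n / 2 := by
      field_simp
    linarith

/-! ### Moments under the channel law. -/

instance isProbabilityMeasure_uniformOn_univ_fin (k : ℕ) [NeZero k] :
    IsProbabilityMeasure (uniformOn (Set.univ : Set (Fin k))) :=
  isProbabilityMeasure_uniformOn Set.finite_univ Set.univ_nonempty

instance isProbabilityMeasure_dirtyMACLaw (n k₁ k₂ : ℕ) [NeZero k₁] [NeZero k₂] (Q : ℝ≥0) :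
    IsProbabilityMeasure (dirtyMACLaw n k₁ k₂ Q) := by
  unfold dirtyMACLaw
  infer_instance

theorem natCast_mul_lintegral_uniformOn_univ (k : ℕ) [NeZero k] (f : Fin k → ℝ≥0∞) :
    k * ∫⁻ m, f m ∂(uniformOn (Set.univ : Set (Fin k))) = ∑ m, f m := by
  rw [lintegral_fintype, Finset.mul_sum]
  refine Finset.sum_congr rfl fun m _ => ?_
  rw [uniformOn_univ]
  have h0 : (k : ℝ≥0∞) ≠ 0 := by simp [NeZero.ne k]
  have h1 : (k : ℝ≥0∞) ≠ ⊤ := by simp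
  simp only [Measure.count_singleton, Fintype.card_fin, ENNReal.div_eq_inv_mul, mul_one]
  rw [mul_left_comm, ENNReal.mul_inv_cancel h0 h1, mul_one]

section Moments

variable {n k₁ k₂ : ℕ} (Q : ℝ≥0)

theorem measurePreserving_dirtyMAC_message₂ [NeZero k₁] :
    MeasurePreserving (fun ω : DirtyMACOutcome n k₁ k₂ => ω.2.1) (dirtyMACLaw n k₁ k₂ Q)
      (uniformOn Set.univ) :=
  measurePreserving_fst.comp measurePreserving_snd

theorem measurePreserving_dirtyMAC_state [NeZero k₁] [NeZero k₂] (i : Fin n) :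
    MeasurePreserving (fun ω : DirtyMACOutcome n k₁ k₂ => ω.2.2.1 i) (dirtyMACLaw n k₁ k₂ Q)
      (gaussianReal 0 Q) :=
  (measurePreserving_eval (fun _ : Fin n => gaussianReal 0 Q) i).comp
    (measurePreserving_fst.comp (measurePreserving_snd.comp measurePreserving_snd))

theorem measurePreserving_dirtyMAC_noise [NeZero k₁] [NeZero k₂] (i : Fin n) :
    MeasurePreserving (fun ω : DirtyMACOutcome n k₁ k₂ => ω.2.2.2 i) (dirtyMACLaw n k₁ k₂ Q)
      (gaussianReal 0 1) :=
  (measurePreserving_eval (fun _ : Fin n => gaussianReal 0 1) i).comp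
    (measurePreserving_snd.comp (measurePreserving_snd.comp measurePreserving_snd))

theorem integral_sq_gaussianReal_zero (v : ℝ≥0) : ∫ x, x ^ 2 ∂(gaussianReal 0 v) = v := by
  have h := variance_fun_id_gaussianReal (μ := 0) (v := v)
  rw [variance_eq_integral (by fun_prop)] at h
  simpa [integral_id_gaussianReal] using h

theorem memLp_dirtyMAC_state [NeZero k₁] [NeZero k₂] (i : Fin n) :
    MemLp (fun ω : DirtyMACOutcome n k₁ k₂ => ω.2.2.1 i) 2 (dirtyMACLaw n k₁ k₂ Q) :=
  (memLp_id_gaussianReal 2).comp_measurePreserving (measurePreserving_dirtyMAC_state Q i)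

theorem memLp_dirtyMAC_noise [NeZero k₁] [NeZero k₂] (i : Fin n) :
    MemLp (fun ω : DirtyMACOutcome n k₁ k₂ => ω.2.2.2 i) 2 (dirtyMACLaw n k₁ k₂ Q) :=
  (memLp_id_gaussianReal 2).comp_measurePreserving (measurePreserving_dirtyMAC_noise Q i)

theorem integral_state_sq [NeZero k₁] [NeZero k₂] (i : Fin n) :
    ∫ ω, ω.2.2.1 i ^ 2 ∂(dirtyMACLaw n k₁ k₂ Q) = Q := by
  rw [← integral_sq_gaussianReal_zero Q,
    ← (measurePreserving_dirtyMAC_state (k₁ := k₁) (k₂ := k₂) Q i).map_eq,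
    integral_map (measurePreserving_dirtyMAC_state (k₁ := k₁) (k₂ := k₂) Q i).aemeasurable (by fun_prop)]

theorem integral_noise_sq [NeZero k₁] [NeZero k₂] (i : Fin n) :
    ∫ ω, ω.2.2.2 i ^ 2 ∂(dirtyMACLaw n k₁ k₂ Q) = 1 := by
  have h := integral_sq_gaussianReal_zero 1
  rw [← (measurePreserving_dirtyMAC_noise (k₁ := k₁) (k₂ := k₂) Q i).map_eq,
    integral_map (measurePreserving_dirtyMAC_noise (k₁ := k₁) (k₂ := k₂) Q i).aemeasurable (by fun_prop)] at h
  exact_mod_cast h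

theorem measurePreserving_neg_pi_gaussianReal (v : ℝ≥0) :
    MeasurePreserving (fun x : Fin n → ℝ => -x) (Measure.pi fun _ => gaussianReal 0 v)
      (Measure.pi fun _ => gaussianReal 0 v) :=
  measurePreserving_pi _ _ fun _ => ⟨measurable_neg, by
    have h := gaussianReal_map_neg (μ := 0) (v := v)
    rw [neg_zero] at h
    exact h⟩

/-- The law is invariant under `z ↦ -z`, which negates the integrand. Since this is a measurable
equivalence, nothing need be assumed about `f`. -/
theorem integral_mul_noise (f : Fin k₁ → Fin k₂ → (Fin n → ℝ) → ℝ) (i : Fin n) :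
    ∫ ω, f ω.1 ω.2.1 ω.2.2.1 * ω.2.2.2 i ∂(dirtyMACLaw n k₁ k₂ Q) = 0 := by
  have h0 := (MeasurePreserving.id (Measure.pi fun _ : Fin n => gaussianReal 0 Q)).prod
    (measurePreserving_neg_pi_gaussianReal (n := n) 1)
  have h1 := (MeasurePreserving.id (uniformOn (Set.univ : Set (Fin k₂)))).prod h0
  have hmp := (MeasurePreserving.id (uniformOn (Set.univ : Set (Fin k₁)))).prod h1
  have h := hmp.integral_comp
    ((MeasurableEquiv.refl _).prodCongr ((MeasurableEquiv.refl _).prodCongr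
      ((MeasurableEquiv.refl _).prodCongr (MeasurableEquiv.neg (Fin n → ℝ))))).measurableEmbedding
    (fun ω : DirtyMACOutcome n k₁ k₂ => f ω.1 ω.2.1 ω.2.2.1 * ω.2.2.2 i)
  simp only [Prod.map_fst, Prod.map_snd, id, Pi.neg_apply, mul_neg, integral_neg] at h
  unfold dirtyMACLaw
  linarith

/-- The same reflection argument applied to the state; here the factor `f` must not depend on `s`.
-/
theorem integral_mul_state (f : Fin k₁ → Fin k₂ → ℝ) (i : Fin n) :
    ∫ ω, f ω.1 ω.2.1 * ω.2.2.1 i ∂(dirtyMACLaw n k₁ k₂ Q) = 0 := by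
  have h0 := (measurePreserving_neg_pi_gaussianReal (n := n) Q).prod
    (MeasurePreserving.id (Measure.pi fun _ : Fin n => gaussianReal 0 1))
  have h1 := (MeasurePreserving.id (uniformOn (Set.univ : Set (Fin k₂)))).prod h0
  have hmp := (MeasurePreserving.id (uniformOn (Set.univ : Set (Fin k₁)))).prod h1
  have h := hmp.integral_comp
    ((MeasurableEquiv.refl _).prodCongr ((MeasurableEquiv.refl _).prodCongr
      ((MeasurableEquiv.neg (Fin n → ℝ)).prodCongr (MeasurableEquiv.refl _)))).measurableEmbedding
    (fun ω : DirtyMACOutcome n k₁ k₂ => f ω.1 ω.2.1 * ω.2.2.1 i)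
  simp only [Prod.map_fst, Prod.map_snd, id, Pi.neg_apply, mul_neg, integral_neg] at h
  unfold dirtyMACLaw
  linarith

/-- For fixed `m₁`, the message `m₂` is independent of the state, so the inner integral factors and
the mean of `g` kills it. -/
theorem integral_mul_message₂ [NeZero k₁] (f : Fin k₁ → (Fin n → ℝ) → ℝ) (g : Fin k₂ → ℝ)
    (hg : ∫ ω, g ω.2.1 ∂(dirtyMACLaw n k₁ k₂ Q) = 0)
    (hfg : Integrable (fun ω => f ω.1 ω.2.2.1 * g ω.2.1) (dirtyMACLaw n k₁ k₂ Q)) :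
    ∫ ω, f ω.1 ω.2.2.1 * g ω.2.1 ∂(dirtyMACLaw n k₁ k₂ Q) = 0 := by
  have hg' : ∫ m, g m ∂(uniformOn (Set.univ : Set (Fin k₂))) = 0 := by
    rw [← hg, ← (measurePreserving_dirtyMAC_message₂ (n := n) (k₁ := k₁) Q).map_eq,
      integral_map (measurePreserving_dirtyMAC_message₂ Q).aemeasurable
        (measurable_of_finite g).aestronglyMeasurable]
  unfold dirtyMACLaw at hfg ⊢
  rw [integral_prod _ hfg]
  refine integral_eq_zero_of_ae (Eventually.of_forall fun m => ?_)
  have h := integral_prod_mul (μ := uniformOn (Set.univ : Set (Fin k₂)))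
    (ν := (Measure.pi fun _ : Fin n => gaussianReal 0 Q).prod
        (Measure.pi fun _ : Fin n => gaussianReal 0 1)) g (fun p => f m p.1)
  rw [hg', zero_mul] at h
  simpa [mul_comm] using h

end Moments

/-- The second moment of a linear combination of square-integrable variables all of whose mixed
moments vanish, except that of the first two. -/
theorem integral_sq_linear_combination {Ω : Type*} [MeasurableSpace Ω] (μ : Measure Ω)
    (X S Z W : Ω → ℝ) (hX : MemLp X 2 μ) (hS : MemLp S 2 μ) (hZ : MemLp Z 2 μ) (hW : MemLp W 2 μ)
    (hXZ : ∫ ω, X ω * Z ω ∂μ = 0) (hXW : ∫ ω, X ω * W ω ∂μ = 0) (hSZ : ∫ ω, S ω * Z ω ∂μ = 0)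
    (hWS : ∫ ω, W ω * S ω ∂μ = 0) (hWZ : ∫ ω, W ω * Z ω ∂μ = 0) (a b c d : ℝ) :
    ∫ ω, (a * X ω + b * S ω + c * Z ω + d * W ω) ^ 2 ∂μ =
      a ^ 2 * ∫ ω, X ω ^ 2 ∂μ + b ^ 2 * ∫ ω, S ω ^ 2 ∂μ + c ^ 2 * ∫ ω, Z ω ^ 2 ∂μ +
        d ^ 2 * ∫ ω, W ω ^ 2 ∂μ + 2 * a * b * ∫ ω, X ω * S ω ∂μ := by
  have iXX := hX.integrable_sq.const_mul (a ^ 2)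
  have iSS := hS.integrable_sq.const_mul (b ^ 2)
  have iZZ := hZ.integrable_sq.const_mul (c ^ 2)
  have iWW := hW.integrable_sq.const_mul (d ^ 2)
  have iXS : Integrable (fun ω => 2 * a * b * (X ω * S ω)) μ :=
    (hX.integrable_mul hS).const_mul _
  have iXZ : Integrable (fun ω => 2 * a * c * (X ω * Z ω)) μ :=
    (hX.integrable_mul hZ).const_mul _
  have iXW : Integrable (fun ω => 2 * a * d * (X ω * W ω)) μ :=
    (hX.integrable_mul hW).const_mul _
  have iSZ : Integrable (fun ω => 2 * b * c * (S ω * Z ω)) μ :=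
    (hS.integrable_mul hZ).const_mul _
  have iWS : Integrable (fun ω => 2 * b * d * (W ω * S ω)) μ :=
    (hW.integrable_mul hS).const_mul _
  have iWZ : Integrable (fun ω => 2 * c * d * (W ω * Z ω)) μ :=
    (hW.integrable_mul hZ).const_mul _
  have h : ∀ ω, (a * X ω + b * S ω + c * Z ω + d * W ω) ^ 2 =
      a ^ 2 * X ω ^ 2 + (b ^ 2 * S ω ^ 2 + (c ^ 2 * Z ω ^ 2 + (d ^ 2 * W ω ^ 2 +
        (2 * a * b * (X ω * S ω) + (2 * a * c * (X ω * Z ω) + (2 * a * d * (X ω * W ω) +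
        (2 * b * c * (S ω * Z ω) + (2 * b * d * (W ω * S ω) +
          2 * c * d * (W ω * Z ω))))))))) := fun ω => by ring
  simp only [h]
  have j1 := iWS.fun_add iWZ
  have j2 := iSZ.fun_add j1
  have j3 := iXW.fun_add j2
  have j4 := iXZ.fun_add j3
  have j5 := iXS.fun_add j4
  have j6 := iWW.fun_add j5
  have j7 := iZZ.fun_add j6
  have j8 := iSS.fun_add j7
  rw [integral_add iXX j8, integral_add iSS j7, integral_add iZZ j6, integral_add iWW j5,
    integral_add iXS j4, integral_add iXZ j3, integral_add iXW j2, integral_add iSZ j1,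
    integral_add iWS iWZ]
  simp only [integral_const_mul, hXZ, hXW, hSZ, hWS, hWZ]
  ring

/-! ### Reference laws for a code. -/

/-- The lower integral is superadditive even for non-measurable functions. Only this direction is
needed to bound reference probabilities from above. -/
theorem sum_lintegral_le_lintegral_sum {α ι : Type*} [MeasurableSpace α] (μ : Measure α)
    (s : Finset ι) (f : ι → α → ℝ≥0∞) :
    ∑ i ∈ s, ∫⁻ a, f i a ∂μ ≤ ∫⁻ a, ∑ i ∈ s, f i a ∂μ := by
  classical
  induction s using Finset.induction_on with
  | empty => simp
  | insert i s hi ih =>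
    simp only [Finset.sum_insert hi]
    exact (add_le_add le_rfl ih).trans (le_lintegral_add _ _)

theorem measurable_sum_gaussianLogRatio {α ι : Type*} [Fintype ι] [MeasurableSpace α]
    (κ Q : ℝ≥0) {f g : ι → α → ℝ} (hf : ∀ i, Measurable (f i)) (hg : ∀ i, Measurable (g i)) :
    Measurable fun x => ∑ i, gaussianLogRatio κ Q (f i x) (g i x) :=
  Finset.measurable_sum _ fun i _ => (hf i).gaussianLogRatio (hg i)

theorem measurable_dirtyMAC_noise {n k₁ k₂ : ℕ} (i : Fin n) :
    Measurable fun ω : DirtyMACOutcome n k₁ k₂ => ω.2.2.2 i := by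
  fun_prop

theorem measurable_dirtyMAC_state {n k₁ k₂ : ℕ} (i : Fin n) :
    Measurable fun ω : DirtyMACOutcome n k₁ k₂ => ω.2.2.1 i := by
  fun_prop

namespace DirtyMACCode

variable {n k₁ k₂ : ℕ} (c : DirtyMACCode n k₁ k₂)

@[fun_prop]
theorem measurable_X₁ : Measurable c.X₁ := by
  have h : Measurable (fun p : Fin k₁ × (Fin n → ℝ) => c.enc₁ p.1 p.2) :=
    measurable_from_prod_countable_right c.measurable_enc₁
  exact h.comp (measurable_fst.prodMk (measurable_fst.comp (measurable_snd.comp measurable_snd)))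

@[fun_prop]
theorem measurable_X₂ : Measurable c.X₂ :=
  (measurable_of_finite c.enc₂).comp (measurable_fst.comp measurable_snd)

@[fun_prop]
theorem measurable_Y : Measurable c.Y := by
  unfold Y
  fun_prop

/-- The messages and the state together with the channel output. -/
def output (ω : DirtyMACOutcome n k₁ k₂) : DirtyMACOutcome n k₁ k₂ :=
  (ω.1, ω.2.1, ω.2.2.1, c.Y ω)

@[fun_prop]
theorem measurable_output : Measurable c.output := by
  unfold output
  fun_prop

/-- Change of measure: weighting the law by the noise ratio makes the output Gaussian around
`u m₁ m₂ s` with variance `κ`. -/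
theorem lintegral_exp_gaussianLogRatio_mul (Q κ : ℝ≥0) (hκ : κ ≠ 0)
    (u : Fin k₁ → Fin k₂ → (Fin n → ℝ) → (Fin n → ℝ))
    (hu : Measurable fun ω : DirtyMACOutcome n k₁ k₂ => u ω.1 ω.2.1 ω.2.2.1)
    (F : DirtyMACOutcome n k₁ k₂ → ℝ≥0∞) (hF : Measurable F) :
    ∫⁻ ω, ENNReal.ofReal (Real.exp
        (-∑ i, gaussianLogRatio κ 1 (c.Y ω i - u ω.1 ω.2.1 ω.2.2.1 i) (ω.2.2.2 i))) *
        F (c.output ω) ∂(dirtyMACLaw n k₁ k₂ Q) =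
      ∫⁻ m₁, ∫⁻ m₂, ∫⁻ s, ∫⁻ y, F (m₁, m₂, s, y)
        ∂(Measure.pi fun i => gaussianReal (u m₁ m₂ s i) κ)
        ∂(Measure.pi fun _ : Fin n => gaussianReal 0 Q)
        ∂(uniformOn (Set.univ : Set (Fin k₂))) ∂(uniformOn (Set.univ : Set (Fin k₁))) := by
  have hu' : ∀ i, Measurable fun ω : DirtyMACOutcome n k₁ k₂ => u ω.1 ω.2.1 ω.2.2.1 i :=
    fun i => (measurable_pi_apply i).comp hu
  have hY : ∀ i, Measurable fun ω : DirtyMACOutcome n k₁ k₂ => c.Y ω i :=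
    fun i => (measurable_pi_apply i).comp c.measurable_Y
  have hG : Measurable fun ω : DirtyMACOutcome n k₁ k₂ => ENNReal.ofReal (Real.exp
        (-∑ i, gaussianLogRatio κ 1 (c.Y ω i - u ω.1 ω.2.1 ω.2.2.1 i) (ω.2.2.2 i))) *
        F (c.output ω) :=
    (ENNReal.measurable_ofReal.comp (Real.measurable_exp.comp (measurable_sum_gaussianLogRatio κ 1
      (fun i => (hY i).sub (hu' i)) measurable_dirtyMAC_noise).neg)).mul
      (hF.comp c.measurable_output)
  unfold dirtyMACLaw
  rw [lintegral_prod _ hG.aemeasurable]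
  refine lintegral_congr fun m₁ => ?_
  have hG₁ := hG.comp (measurable_prodMk_left (x := m₁))
  refine (lintegral_prod _ hG₁.aemeasurable).trans (lintegral_congr fun m₂ => ?_)
  have hG₂ := hG₁.comp (measurable_prodMk_left (x := m₂))
  refine (lintegral_prod _ hG₂.aemeasurable).trans (lintegral_congr fun s => ?_)
  exact lintegral_shift_pi_gaussianReal κ hκ (c.enc₁ m₁ s + c.enc₂ m₂ + s) (u m₁ m₂ s)
    (fun y => F (m₁, m₂, s, y)) (by fun_prop)

theorem measurableSet_dec₁ :
    MeasurableSet {p : DirtyMACOutcome n k₁ k₂ | (c.dec p.2.2.2).1 = p.1} := by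
  have h : Measurable fun p : DirtyMACOutcome n k₁ k₂ => ((c.dec p.2.2.2).1, p.1) := by
    have := c.measurable_dec
    fun_prop
  exact h (MeasurableSet.of_discrete (s := {q : Fin k₁ × Fin k₁ | q.1 = q.2}))

theorem measurableSet_dec₂ :
    MeasurableSet {p : DirtyMACOutcome n k₁ k₂ | (c.dec p.2.2.2).2 = p.2.1} := by
  have h : Measurable fun p : DirtyMACOutcome n k₁ k₂ => ((c.dec p.2.2.2).2, p.2.1) := by
    have := c.measurable_dec
    fun_prop
  exact h (MeasurableSet.of_discrete (s := {q : Fin k₂ × Fin k₂ | q.1 = q.2}))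

theorem measurableSet_dec :
    MeasurableSet {p : DirtyMACOutcome n k₁ k₂ | c.dec p.2.2.2 = (p.1, p.2.1)} := by
  have h : Measurable fun p : DirtyMACOutcome n k₁ k₂ => (c.dec p.2.2.2, (p.1, p.2.1)) := by
    have := c.measurable_dec
    fun_prop
  exact h (MeasurableSet.of_discrete
    (s := {q : (Fin k₁ × Fin k₂) × (Fin k₁ × Fin k₂) | q.1 = q.2}))

/-- The event `C` may exceed that of correct decoding, so that a single-user bound can ask for one
message only. -/
theorem one_sub_errorProb_le [NeZero k₁] [NeZero k₂] (Q : ℝ≥0)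
    (C : Set (DirtyMACOutcome n k₁ k₂))
    (hC : {p : DirtyMACOutcome n k₁ k₂ | c.dec p.2.2.2 = (p.1, p.2.1)} ⊆ C) :
    1 - c.errorProb Q ≤ (dirtyMACLaw n k₁ k₂ Q).real (c.output ⁻¹' C) := by
  have h : {ω : DirtyMACOutcome n k₁ k₂ | c.dec (c.Y ω) ≠ (ω.1, ω.2.1)} =
      (c.output ⁻¹' {p | c.dec p.2.2.2 = (p.1, p.2.1)})ᶜ := rfl
  rw [errorProb, h, probReal_compl_eq_one_sub (c.measurable_output c.measurableSet_dec),
    sub_sub_cancel]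
  exact measureReal_mono (Set.preimage_mono hC)

/-- Single-user bounds: a reference under which the output given `(m₁, m₂, s)` is Gaussian with
variance `κ` around `u m₁ m₂ s`, and the event `C` has probability at most `1 / K`. -/
theorem one_sub_errorProb_mul_log_le [NeZero k₁] [NeZero k₂] (Q κ : ℝ≥0) (hκ : κ ≠ 0)
    (u : Fin k₁ → Fin k₂ → (Fin n → ℝ) → (Fin n → ℝ))
    (hu : Measurable fun ω : DirtyMACOutcome n k₁ k₂ => u ω.1 ω.2.1 ω.2.2.1)
    (hmem : ∀ i, MemLp (fun ω => c.Y ω i - u ω.1 ω.2.1 ω.2.2.1 i) 2 (dirtyMACLaw n k₁ k₂ Q))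
    (hpow : ∑ i, ∫ ω, (c.Y ω i - u ω.1 ω.2.1 ω.2.2.1 i) ^ 2 ∂(dirtyMACLaw n k₁ k₂ Q) ≤ n * κ)
    (C : Set (DirtyMACOutcome n k₁ k₂)) (hCm : MeasurableSet C)
    (hC : {p : DirtyMACOutcome n k₁ k₂ | c.dec p.2.2.2 = (p.1, p.2.1)} ⊆ C)
    (K : ℕ) (hK : 1 ≤ K)
    (hCK : K * ∫⁻ m₁, ∫⁻ m₂, ∫⁻ s, ∫⁻ y, C.indicator 1 (m₁, m₂, s, y)
        ∂(Measure.pi fun i => gaussianReal (u m₁ m₂ s i) κ)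
        ∂(Measure.pi fun _ : Fin n => gaussianReal 0 Q)
        ∂(uniformOn (Set.univ : Set (Fin k₂))) ∂(uniformOn (Set.univ : Set (Fin k₁))) ≤ 1) :
    (1 - c.errorProb Q) * Real.log K ≤ n / 2 * Real.log κ + Real.log 2 := by
  have hu' : ∀ i, Measurable fun ω : DirtyMACOutcome n k₁ k₂ => u ω.1 ω.2.1 ω.2.2.1 i :=
    fun i => (measurable_pi_apply i).comp hu
  have hY : ∀ i, Measurable fun ω : DirtyMACOutcome n k₁ k₂ => c.Y ω i :=
    fun i => (measurable_pi_apply i).comp c.measurable_Y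
  obtain ⟨hLi, hLe⟩ := integral_sum_gaussianLogRatio_le (dirtyMACLaw n k₁ k₂ Q) κ 1 hκ
    (fun i ω => c.Y ω i - u ω.1 ω.2.1 ω.2.2.1 i) (fun i ω => ω.2.2.2 i) hmem
    (memLp_dirtyMAC_noise Q) (by simpa using hpow) (by simp [integral_noise_sq])
  have hfano := measureReal_mul_log_le (dirtyMACLaw n k₁ k₂ Q)
    (fun ω => ∑ i, gaussianLogRatio κ 1 (c.Y ω i - u ω.1 ω.2.1 ω.2.2.1 i) (ω.2.2.2 i))
    (measurable_sum_gaussianLogRatio κ 1 (fun i => (hY i).sub (hu' i)) measurable_dirtyMAC_noise)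
    hLi (c.output ⁻¹' C) (c.measurable_output hCm) K hK
    (by
      have h := c.lintegral_exp_gaussianLogRatio_mul Q κ hκ u hu 1 measurable_one
      simp only [Pi.one_apply, mul_one] at h
      rw [h]
      simp)
    (by
      have h := c.lintegral_exp_gaussianLogRatio_mul Q κ hκ u hu (C.indicator 1)
        (measurable_one.indicator hCm)
      rw [← h] at hCK
      exact hCK)
  have hlog : 0 ≤ Real.log K := Real.log_natCast_nonneg K
  have := mul_le_mul_of_nonneg_right (c.one_sub_errorProb_le Q C hC) hlog
  linarith

/-- The reference centre `x₂ + (1 + β) s` does not involve `m₁`, so `m₁` is guessed with probability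
at most `1 / k₁`; the residual of the output is `X₁ - β S + Z`. -/
theorem one_sub_errorProb_mul_log_card₁_le [NeZero k₁] [NeZero k₂] (Q κ : ℝ≥0) (hκ : κ ≠ 0)
    (β : ℝ) (hmem : ∀ i, MemLp (fun ω => c.X₁ ω i) 2 (dirtyMACLaw n k₁ k₂ Q))
    (hpow : ∑ i, ∫ ω, (c.X₁ ω i - β * ω.2.2.1 i + ω.2.2.2 i) ^ 2 ∂(dirtyMACLaw n k₁ k₂ Q) ≤
      n * κ) :
    (1 - c.errorProb Q) * Real.log k₁ ≤ n / 2 * Real.log κ + Real.log 2 := by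
  have hD : ∀ (ω : DirtyMACOutcome n k₁ k₂) i,
      c.Y ω i - (c.enc₂ ω.2.1 + (1 + β) • ω.2.2.1) i =
        c.X₁ ω i - β * ω.2.2.1 i + ω.2.2.2 i := fun ω i => by
    simp only [Y, X₂, Pi.add_apply, Pi.smul_apply, smul_eq_mul]
    ring
  refine c.one_sub_errorProb_mul_log_le Q κ hκ (fun _ m₂ s => c.enc₂ m₂ + (1 + β) • s) ?_ ?_ ?_
    {p | (c.dec p.2.2.2).1 = p.1} c.measurableSet_dec₁ (fun p hp => congrArg Prod.fst hp) k₁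
    (NeZero.one_le) ?_
  · exact c.measurable_X₂.add (by fun_prop)
  · intro i
    simp only [hD]
    exact ((hmem i).sub ((memLp_dirtyMAC_state Q i).const_mul β)).add (memLp_dirtyMAC_noise Q i)
  · simpa only [hD] using hpow
  -- The factor `k₁` turns the average over `m₁` into a sum. The events of decoding to each `m₁`
  -- partition the outputs, whose reference law is the same for all `m₁`.
  · rw [natCast_mul_lintegral_uniformOn_univ]
    refine (sum_lintegral_le_lintegral_sum _ _ _).trans ?_
    refine (lintegral_mono fun m₂ => (sum_lintegral_le_lintegral_sum _ _ _).trans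
      (lintegral_mono fun s => (sum_lintegral_le_lintegral_sum _ _ _).trans_eq
        (lintegral_congr fun y => ?_))).trans_eq (b := ∫⁻ m₂, ∫⁻ s, ∫⁻ y, 1
        ∂(Measure.pi fun i => gaussianReal ((c.enc₂ m₂ + (1 + β) • s) i) κ)
        ∂(Measure.pi fun _ : Fin n => gaussianReal 0 Q)
        ∂(uniformOn (Set.univ : Set (Fin k₂)))) ?_
    · simp [Set.indicator_apply]
    · simp

/-- Centring at `x₁ + s` amounts to revealing `m₁` and the state to the decoder; only `X₂ + Z` is
left. -/
theorem one_sub_errorProb_mul_log_card₂_le [NeZero k₁] [NeZero k₂] (Q κ : ℝ≥0) (hκ : κ ≠ 0)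
    (hmem : ∀ i, MemLp (fun ω => c.X₂ ω i) 2 (dirtyMACLaw n k₁ k₂ Q))
    (hpow : ∑ i, ∫ ω, (c.X₂ ω i + ω.2.2.2 i) ^ 2 ∂(dirtyMACLaw n k₁ k₂ Q) ≤ n * κ) :
    (1 - c.errorProb Q) * Real.log k₂ ≤ n / 2 * Real.log κ + Real.log 2 := by
  have hD : ∀ (ω : DirtyMACOutcome n k₁ k₂) i,
      c.Y ω i - (c.enc₁ ω.1 ω.2.2.1 + ω.2.2.1) i = c.X₂ ω i + ω.2.2.2 i := fun ω i => by
    simp only [Y, X₁, Pi.add_apply]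
    ring
  refine c.one_sub_errorProb_mul_log_le Q κ hκ (fun m₁ _ s => c.enc₁ m₁ s + s) ?_ ?_ ?_
    {p | (c.dec p.2.2.2).2 = p.2.1} c.measurableSet_dec₂ (fun p hp => congrArg Prod.snd hp) k₂
    (NeZero.one_le) ?_
  · exact c.measurable_X₁.add (by fun_prop)
  · intro i
    simp only [hD]
    exact (hmem i).add (memLp_dirtyMAC_noise Q i)
  · simpa only [hD] using hpow
  · rw [← lintegral_const_mul' _ _ (by simp)]
    simp only [natCast_mul_lintegral_uniformOn_univ]
    refine (lintegral_mono fun m₁ => (sum_lintegral_le_lintegral_sum _ _ _).trans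
      (lintegral_mono fun s => (sum_lintegral_le_lintegral_sum _ _ _).trans_eq
        (lintegral_congr fun y => ?_))).trans_eq (b := ∫⁻ m₁, ∫⁻ s, ∫⁻ y, 1
        ∂(Measure.pi fun i => gaussianReal ((c.enc₁ m₁ s + s) i) κ)
        ∂(Measure.pi fun _ : Fin n => gaussianReal 0 Q)
        ∂(uniformOn (Set.univ : Set (Fin k₁)))) ?_
    · simp [Set.indicator_apply]
    · simp

/-- Sum-rate bound. The reference draws the output from `N(ν, V I)` independently of the messages,
and then the state from `N(α (y - x₂), κ Q I)`. -/
theorem one_sub_errorProb_mul_log_card_le [NeZero k₁] [NeZero k₂] (Q V κ : ℝ≥0) (hV : V ≠ 0)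
    (hκ : κ ≠ 0) (α : ℝ) (ν : Fin n → ℝ) (hQ : Q = 0 → κ = 1 ∧ α = 0)
    (hmem₁ : ∀ i, MemLp (fun ω => c.X₁ ω i) 2 (dirtyMACLaw n k₁ k₂ Q))
    (hmem₂ : ∀ i, MemLp (fun ω => c.X₂ ω i) 2 (dirtyMACLaw n k₁ k₂ Q))
    (hpowY : ∑ i, ∫ ω, (c.Y ω i - ν i) ^ 2 ∂(dirtyMACLaw n k₁ k₂ Q) ≤ n * V)
    (hpowS : ∑ i, ∫ ω, (ω.2.2.1 i - α * (c.Y ω i - c.X₂ ω i)) ^ 2 ∂(dirtyMACLaw n k₁ k₂ Q) ≤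
      n * (κ * Q)) :
    (1 - c.errorProb Q) * (Real.log k₁ + Real.log k₂) ≤
      n / 2 * (Real.log V + Real.log κ) + Real.log 2 := by
  have hYm : ∀ i, Measurable fun ω : DirtyMACOutcome n k₁ k₂ => c.Y ω i :=
    fun i => (measurable_pi_apply i).comp c.measurable_Y
  have hX₂m : ∀ i, Measurable fun ω : DirtyMACOutcome n k₁ k₂ => c.X₂ ω i :=
    fun i => (measurable_pi_apply i).comp c.measurable_X₂
  have hYmem : ∀ i, MemLp (fun ω => c.Y ω i) 2 (dirtyMACLaw n k₁ k₂ Q) := fun i =>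
    (((hmem₁ i).add (hmem₂ i)).add (memLp_dirtyMAC_state Q i)).add (memLp_dirtyMAC_noise Q i)
  obtain ⟨hLi, hLe⟩ := integral_sum_gaussianLogRatio_le (dirtyMACLaw n k₁ k₂ Q) V 1 hV
    (fun i ω => c.Y ω i - ν i) (fun i ω => ω.2.2.2 i)
    (fun i => (hYmem i).sub (memLp_const (ν i)))
    (memLp_dirtyMAC_noise Q) (by simpa using hpowY) (by simp [integral_noise_sq])
  obtain ⟨hLi', hLe'⟩ := integral_sum_gaussianLogRatio_le (dirtyMACLaw n k₁ k₂ Q) κ Q hκ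
    (fun i ω => ω.2.2.1 i - α * (c.Y ω i - c.X₂ ω i)) (fun i ω => ω.2.2.1 i)
    (fun i => (memLp_dirtyMAC_state Q i).sub (((hYmem i).sub (hmem₂ i)).const_mul α))
    (memLp_dirtyMAC_state Q) hpowS (by simp [integral_state_sq])
  -- Density of the reference conditional law of the state given `y` and `m₂`, relative to its true
  -- law.
  set R : DirtyMACOutcome n k₁ k₂ → ℝ≥0∞ := fun p => ENNReal.ofReal (Real.exp
    (-∑ i, gaussianLogRatio κ Q (p.2.2.1 i - α * (p.2.2.2 i - c.enc₂ p.2.1 i)) (p.2.2.1 i)))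
    with hR
  have hRm : Measurable R := by
    have hx : ∀ i, Measurable fun p : DirtyMACOutcome n k₁ k₂ => c.enc₂ p.2.1 i := hX₂m
    exact ENNReal.measurable_ofReal.comp (Real.measurable_exp.comp
      (measurable_sum_gaussianLogRatio κ Q (fun i => (measurable_dirtyMAC_state i).sub
        (((measurable_dirtyMAC_noise i).sub (hx i)).const_mul α)) measurable_dirtyMAC_state).neg)
  have hRint : ∀ m₁ m₂ y, ∫⁻ s, R (m₁, m₂, s, y)
      ∂(Measure.pi fun _ : Fin n => gaussianReal 0 Q) = 1 := fun m₁ m₂ y =>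
    lintegral_pi_gaussianReal_exp_gaussianLogRatio κ Q hκ (fun i => α * (y i - c.enc₂ m₂ i))
      fun h => ⟨(hQ h).1, by ext i; simp [(hQ h).2]⟩
  have hsplit : ∀ ω, ENNReal.ofReal (Real.exp (-(∑ i, gaussianLogRatio V 1 (c.Y ω i - ν i)
      (ω.2.2.2 i) + ∑ i, gaussianLogRatio κ Q (ω.2.2.1 i - α * (c.Y ω i - c.X₂ ω i))
      (ω.2.2.1 i)))) = ENNReal.ofReal (Real.exp (-∑ i, gaussianLogRatio V 1 (c.Y ω i - ν i)
      (ω.2.2.2 i))) * R (c.output ω) := fun ω => by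
    rw [neg_add, Real.exp_add, ENNReal.ofReal_mul (Real.exp_pos _).le]
    rfl
  -- Integrating over `s` first, `R` has mass one for every `y`, so the messages drop out and the
  -- output has law `N(ν, V I)`.
  have hswap : ∀ (m₁ : Fin k₁) (m₂ : Fin k₂) (A : Set (Fin n → ℝ)), MeasurableSet A →
      ∫⁻ s, ∫⁻ y, R (m₁, m₂, s, y) * A.indicator 1 y
        ∂(Measure.pi fun i => gaussianReal (ν i) V)
        ∂(Measure.pi fun _ : Fin n => gaussianReal 0 Q) =
      ∫⁻ y, A.indicator 1 y ∂(Measure.pi fun i => gaussianReal (ν i) V) := fun m₁ m₂ A hA => by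
    have hAm : Measurable (A.indicator (1 : (Fin n → ℝ) → ℝ≥0∞)) := measurable_one.indicator hA
    rw [lintegral_lintegral_swap]
    · refine lintegral_congr fun y => ?_
      rw [lintegral_mul_const _ (by fun_prop), hRint, one_mul]
    · refine Measurable.aemeasurable ?_
      exact (hRm.comp (by fun_prop : Measurable fun q : (Fin n → ℝ) × (Fin n → ℝ) =>
        ((m₁, m₂, q.1, q.2) : DirtyMACOutcome n k₁ k₂))).mul (hAm.comp measurable_snd)
  set C : Set (DirtyMACOutcome n k₁ k₂) := {p | c.dec p.2.2.2 = (p.1, p.2.1)} with hCdef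
  have hCm : MeasurableSet C := c.measurableSet_dec
  have hCind : Measurable (C.indicator (1 : DirtyMACOutcome n k₁ k₂ → ℝ≥0∞)) := measurable_one.indicator hCm
  have hfano := measureReal_mul_log_le (dirtyMACLaw n k₁ k₂ Q)
    (fun ω => ∑ i, gaussianLogRatio V 1 (c.Y ω i - ν i) (ω.2.2.2 i) +
      ∑ i, gaussianLogRatio κ Q (ω.2.2.1 i - α * (c.Y ω i - c.X₂ ω i)) (ω.2.2.1 i))
    ((measurable_sum_gaussianLogRatio V 1 (fun i => (hYm i).sub_const _)
      measurable_dirtyMAC_noise).add (measurable_sum_gaussianLogRatio κ Q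
        (fun i => (measurable_dirtyMAC_state i).sub (((hYm i).sub (hX₂m i)).const_mul α))
        measurable_dirtyMAC_state))
    (hLi.add hLi') (c.output ⁻¹' C) (c.measurable_output hCm) (k₁ * k₂)
    (Nat.mul_pos (NeZero.pos k₁) (NeZero.pos k₂))
    (by
      simp only [hsplit]
      rw [c.lintegral_exp_gaussianLogRatio_mul Q V hV (fun _ _ _ => ν) measurable_const R hRm]
      have h := fun m₁ m₂ => hswap m₁ m₂ Set.univ MeasurableSet.univ
      simp only [Set.indicator_univ, Pi.one_apply, mul_one, lintegral_const, measure_univ] at h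
      simp [h])
    (by
      simp only [hsplit]
      have h := c.lintegral_exp_gaussianLogRatio_mul Q V hV (fun _ _ _ => ν) measurable_const
        (fun p => R p * C.indicator 1 p) (hRm.mul hCind)
      have h' : ∀ ω, (c.output ⁻¹' C).indicator (1 : DirtyMACOutcome n k₁ k₂ → ℝ≥0∞) ω =
        C.indicator 1 (c.output ω) := fun ω => rfl
      simp only [← mul_assoc] at h
      simp only [h']
      rw [h]
      have hs : ∀ m₁ m₂, ∫⁻ s, ∫⁻ y, R (m₁, m₂, s, y) * C.indicator 1 (m₁, m₂, s, y)
          ∂(Measure.pi fun i => gaussianReal (ν i) V)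
          ∂(Measure.pi fun _ : Fin n => gaussianReal 0 Q) =
          ∫⁻ y, {y | c.dec y = (m₁, m₂)}.indicator 1 y
            ∂(Measure.pi fun i => gaussianReal (ν i) V) := fun m₁ m₂ =>
        hswap m₁ m₂ {y | c.dec y = (m₁, m₂)} (c.measurable_dec (measurableSet_singleton _))
      simp only [hs]
      rw [Nat.cast_mul, mul_assoc, ← lintegral_const_mul' _ _ (by simp)]
      simp only [natCast_mul_lintegral_uniformOn_univ]
      refine (Finset.sum_le_sum fun m₁ _ => sum_lintegral_le_lintegral_sum _ _ _).trans
        ((sum_lintegral_le_lintegral_sum _ _ _).trans_eq ?_)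
      -- Each output is decoded to exactly one pair, so under the reference a correct guess has
      -- probability `1 / (k₁ k₂)`.
      have hone : ∀ y, ∑ m₁, ∑ m₂, {y | c.dec y = (m₁, m₂)}.indicator (1 : (Fin n → ℝ) → ℝ≥0∞) y = 1 :=
        fun y => by
        rw [← Fintype.sum_prod_type' (f := fun m₁ m₂ =>
          {y | c.dec y = (m₁, m₂)}.indicator (1 : (Fin n → ℝ) → ℝ≥0∞) y)]
        simp [Set.indicator_apply]
      simp [hone])
  rw [integral_add hLi hLi', Nat.cast_mul, Real.log_mul (by simp [NeZero.ne k₁])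
    (by simp [NeZero.ne k₂])] at hfano
  have hlog : 0 ≤ Real.log k₁ + Real.log k₂ :=
    add_nonneg (Real.log_natCast_nonneg k₁) (Real.log_natCast_nonneg k₂)
  have := mul_le_mul_of_nonneg_right (c.one_sub_errorProb_le Q C le_rfl) hlog
  linarith

end DirtyMACCode

/-! ### Choice of the reference parameters from the power constraints. -/

theorem memLp_and_sum_integral_sq_le {Ω : Type*} [MeasurableSpace Ω] (μ : Measure Ω) {n : ℕ}
    (X : Fin n → Ω → ℝ) (hX : ∀ i, Measurable (X i)) (P : ℝ≥0)
    (h : ∑ i, ∫⁻ ω, ENNReal.ofReal (X i ω ^ 2) ∂μ ≤ (n : ℝ≥0∞) * P) :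
    (∀ i, MemLp (X i) 2 μ) ∧ ∑ i, ∫ ω, X i ω ^ 2 ∂μ ≤ n * P := by
  have hmem : ∀ i, MemLp (X i) 2 μ := fun i => by
    rw [memLp_two_iff_integrable_sq (hX i).aestronglyMeasurable]
    refine ⟨((hX i).pow_const 2).aestronglyMeasurable, ?_⟩
    rw [hasFiniteIntegral_iff_ofReal (Eventually.of_forall fun ω => sq_nonneg _)]
    refine ((Finset.single_le_sum
      (f := fun i => ∫⁻ ω, ENNReal.ofReal (X i ω ^ 2) ∂μ) (fun _ _ => zero_le)
      (Finset.mem_univ i)).trans h).trans_lt ?_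
    exact ENNReal.mul_lt_top (by simp) (by simp)
  refine ⟨hmem, ?_⟩
  simp only [← ofReal_integral_eq_lintegral_ofReal (hmem _).integrable_sq
    (Eventually.of_forall fun ω => sq_nonneg _)] at h
  rw [← ENNReal.ofReal_sum_of_nonneg fun i _ => integral_nonneg fun ω => sq_nonneg _] at h
  have h' : ENNReal.ofReal (∑ i, ∫ ω, X i ω ^ 2 ∂μ) ≤ ENNReal.ofReal (n * P) := by
    rw [ENNReal.ofReal_mul (Nat.cast_nonneg n), ENNReal.ofReal_natCast, ENNReal.ofReal_coe_nnreal]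
    exact h
  exact (ENNReal.ofReal_le_ofReal_iff (by positivity)).1 h'

namespace DirtyMACCode

variable {n k₁ k₂ : ℕ} (c : DirtyMACCode n k₁ k₂)

/-- Converse at a fixed blocklength, in terms of the average correlation `C` between the state and
the input of the cognitive user. -/
theorem exists_correlation_converse [NeZero n] [NeZero k₁] [NeZero k₂] (P₁ P₂ Q : ℝ≥0)
    (hpow : c.SatisfiesPower P₁ P₂ Q) :
    ∃ C : ℝ, C ^ 2 ≤ P₁ * Q ∧
      (1 - c.errorProb Q) * Real.log k₁ ≤
        n / 2 * Real.log (1 + P₁ - C ^ 2 / Q) + Real.log 2 ∧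
      (1 - c.errorProb Q) * Real.log k₂ ≤ n / 2 * Real.log (1 + P₂) + Real.log 2 ∧
      (1 - c.errorProb Q) * (Real.log k₁ + Real.log k₂) ≤
        n / 2 * (Real.log (P₂ + (1 + P₁ + Q + 2 * C)) +
          Real.log ((1 + P₁ - C ^ 2 / Q) / (1 + P₁ + Q + 2 * C))) + Real.log 2 := by
  set μ := dirtyMACLaw n k₁ k₂ Q with hμ
  have hn : (0 : ℝ) < n := by exact_mod_cast NeZero.pos n
  obtain ⟨hm₁, hp₁⟩ := memLp_and_sum_integral_sq_le μ (fun i ω => c.X₁ ω i)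
    (fun i => (measurable_pi_apply i).comp c.measurable_X₁) P₁ hpow.1
  obtain ⟨hm₂, hp₂⟩ := memLp_and_sum_integral_sq_le μ (fun i ω => c.X₂ ω i)
    (fun i => (measurable_pi_apply i).comp c.measurable_X₂) P₂ hpow.2
  -- Codewords of user 2 may have nonzero mean, which could correlate with the mean of `X₁`.
  -- Centring removes that cross term and does not increase the power.
  set ν : Fin n → ℝ := fun i => ∫ ω, c.X₂ ω i ∂μ with hν
  have hmW : ∀ i, MemLp (fun ω => c.X₂ ω i - ν i) 2 μ := fun i => (hm₂ i).sub (memLp_const _)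
  have hpW : ∑ i, ∫ ω, (c.X₂ ω i - ν i) ^ 2 ∂μ ≤ n * P₂ :=
    (Finset.sum_le_sum fun i _ => by
      have h := variance_le_expectation_sq (X := fun ω => c.X₂ ω i) (μ := μ)
        (hm₂ i).aestronglyMeasurable
      rw [variance_eq_integral (hm₂ i).aemeasurable] at h
      exact h).trans hp₂
  have hlin : ∀ (a b d w : ℝ) (i : Fin n),
      ∫ ω, (a * c.X₁ ω i + b * ω.2.2.1 i + d * ω.2.2.2 i + w * (c.X₂ ω i - ν i)) ^ 2 ∂μ =
      a ^ 2 * ∫ ω, c.X₁ ω i ^ 2 ∂μ + b ^ 2 * Q + d ^ 2 +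
        w ^ 2 * ∫ ω, (c.X₂ ω i - ν i) ^ 2 ∂μ +
        2 * a * b * ∫ ω, c.X₁ ω i * ω.2.2.1 i ∂μ := fun a b d w i => by
    rw [integral_sq_linear_combination μ (fun ω => c.X₁ ω i) (fun ω => ω.2.2.1 i)
      (fun ω => ω.2.2.2 i) (fun ω => c.X₂ ω i - ν i) (hm₁ i) (memLp_dirtyMAC_state Q i)
      (memLp_dirtyMAC_noise Q i) (hmW i)
      (integral_mul_noise Q (fun m₁ _ s => c.enc₁ m₁ s i) i)
      (integral_mul_message₂ Q (fun m₁ s => c.enc₁ m₁ s i) (fun m₂ => c.enc₂ m₂ i - ν i)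
        ?_ ((hm₁ i).integrable_mul (hmW i)))
      (integral_mul_noise Q (fun _ _ s => s i) i)
      (integral_mul_state Q (fun _ m₂ => c.enc₂ m₂ i - ν i) i)
      (integral_mul_noise Q (fun _ m₂ _ => c.enc₂ m₂ i - ν i) i) a b d w,
      integral_state_sq, integral_noise_sq, mul_one]
    have h : ∫ ω, (c.X₂ ω i - ν i) ∂μ = 0 := by
      rw [integral_sub ((hm₂ i).integrable one_le_two) (integrable_const _)]
      simp [hν]
    exact h
  set C : ℝ := (∑ i, ∫ ω, c.X₁ ω i * ω.2.2.1 i ∂μ) / n with hCdef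
  have hC : ∑ i, ∫ ω, c.X₁ ω i * ω.2.2.1 i ∂μ = n * C := by
    rw [hCdef]
    field_simp
  have hsum : ∀ a b d w : ℝ, ∑ i, ∫ ω,
      (a * c.X₁ ω i + b * ω.2.2.1 i + d * ω.2.2.2 i + w * (c.X₂ ω i - ν i)) ^ 2 ∂μ ≤
      n * (a ^ 2 * P₁ + b ^ 2 * Q + d ^ 2 + w ^ 2 * P₂ + 2 * a * b * C) := fun a b d w => by
    simp only [hlin, Finset.sum_add_distrib, ← Finset.mul_sum, hC, Finset.sum_const,
      Finset.card_univ, Fintype.card_fin, nsmul_eq_mul]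
    have h1 := mul_le_mul_of_nonneg_left hp₁ (sq_nonneg a)
    have h2 := mul_le_mul_of_nonneg_left hpW (sq_nonneg w)
    linarith
  -- The quadratic bounds the average power of `X₁ + t S`. Its discriminant yields Cauchy–Schwarz
  -- for `C`; the value at `t = 1` yields positivity of the variance of `X₁ + S + Z`.
  have hquad : ∀ t : ℝ, 0 ≤ Q * (t * t) + 2 * C * t + P₁ := fun t => by
    have h := (Finset.sum_nonneg fun i _ => integral_nonneg fun ω => sq_nonneg _).trans
      (hsum 1 t 0 0)
    have := nonneg_of_mul_nonneg_right h hn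
    linarith
  have hCsq : C ^ 2 ≤ P₁ * Q := by
    have h := discrim_le_zero hquad
    rw [discrim] at h
    linarith
  have hV₁ : 0 < 1 + P₁ + Q + 2 * C := by
    have := hquad 1
    linarith
  have he : 0 < 1 + P₁ - C ^ 2 / Q := by
    have := div_le_of_le_mul₀ Q.2 P₁.2 hCsq
    change C ^ 2 / (Q : ℝ) ≤ P₁ at this
    linarith
  have hQ0 : Q = 0 → C = 0 := fun h => by
    rw [h] at hCsq
    simpa using hCsq
  have hCQ : C ^ 2 / Q * Q = C ^ 2 := by
    rcases eq_or_ne Q 0 with h | h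
    · simp [h, hQ0 h]
    · field_simp
  refine ⟨C, hCsq, ?_, ?_, ?_⟩
  -- `C / Q` is the linear least-squares coefficient of `X₁` on `S`; the residual plus noise has
  -- power at most `1 + P₁ - C² / Q`.
  · have h := c.one_sub_errorProb_mul_log_card₁_le Q (1 + P₁ - C ^ 2 / Q).toNNReal
      (Real.toNNReal_pos.2 he).ne' (C / Q) hm₁ (by
        rw [Real.coe_toNNReal _ he.le]
        have h1 := hsum 1 (-(C / Q)) 1 0
        have h2 : ∀ (ω : DirtyMACOutcome n k₁ k₂) i, 1 * c.X₁ ω i + -(C / Q) * ω.2.2.1 i +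
          1 * ω.2.2.2 i + 0 * (c.X₂ ω i - ν i) =
          c.X₁ ω i - C / Q * ω.2.2.1 i + ω.2.2.2 i := fun ω i => by ring
        simp only [h2] at h1
        refine h1.trans_eq ?_
        rcases eq_or_ne Q 0 with h | h
        · simp [h, add_comm]
        · field_simp
          ring)
    rwa [Real.coe_toNNReal _ he.le] at h
  · have h := c.one_sub_errorProb_mul_log_card₂_le Q (1 + P₂) (by positivity) hm₂ (by
        have hz : MemLp (fun _ : DirtyMACOutcome n k₁ k₂ => (0 : ℝ)) 2 μ := memLp_const 0
        have h1 : ∀ i, ∫ ω, (c.X₂ ω i + ω.2.2.2 i) ^ 2 ∂μ = ∫ ω, c.X₂ ω i ^ 2 ∂μ + 1 := fun i => by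
          have h2 := integral_sq_linear_combination μ (fun ω => c.X₂ ω i) (fun _ => 0)
            (fun ω => ω.2.2.2 i) (fun _ => 0) (hm₂ i) hz (memLp_dirtyMAC_noise Q i) hz
            (integral_mul_noise Q (fun _ m₂ _ => c.enc₂ m₂ i) i) (by simp) (by simp) (by simp)
            (by simp) 1 0 1 0
          rw [integral_noise_sq] at h2
          simpa using h2
        simp only [← hμ, h1, Finset.sum_add_distrib]
        simp only [Finset.sum_const, Finset.card_univ, Fintype.card_fin, nsmul_eq_mul, mul_one,
          NNReal.coe_add, NNReal.coe_one]
        linarith)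
    simpa using h
  -- The linear least-squares coefficient of `S` on `Y - X₂ = X₁ + S + Z`: covariance `Q + C` over
  -- variance `1 + P₁ + Q + 2C`.
  · set α : ℝ := (Q + C) / (1 + P₁ + Q + 2 * C) with hα
    have hV : (0 : ℝ) < P₂ + (1 + P₁ + Q + 2 * C) := add_pos_of_nonneg_of_pos P₂.2 hV₁
    have hκ := div_pos he hV₁
    have h := c.one_sub_errorProb_mul_log_card_le Q (P₂ + (1 + P₁ + Q + 2 * C)).toNNReal
      ((1 + P₁ - C ^ 2 / Q) / (1 + P₁ + Q + 2 * C)).toNNReal (Real.toNNReal_pos.2 hV).ne'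
      (Real.toNNReal_pos.2 hκ).ne' α ν
      (fun hQ => by
        have hC0 := hQ0 hQ
        have : (1 + P₁ : ℝ) ≠ 0 := by positivity
        constructor
        · simp [hQ, hC0, div_self this]
        · simp [hα, hQ, hC0])
      hm₁ hm₂
      (by
        rw [Real.coe_toNNReal _ hV.le]
        have h1 := hsum 1 1 1 1
        have h2 : ∀ (ω : DirtyMACOutcome n k₁ k₂) i, 1 * c.X₁ ω i + 1 * ω.2.2.1 i +
            1 * ω.2.2.2 i + 1 * (c.X₂ ω i - ν i) = c.Y ω i - ν i := fun ω i => by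
          simp only [Y, Pi.add_apply]
          ring
        simp only [h2] at h1
        exact h1.trans_eq (by ring))
      (by
        rw [Real.coe_toNNReal _ hκ.le]
        have h1 := hsum (-α) (1 - α) (-α) 0
        have h2 : ∀ (ω : DirtyMACOutcome n k₁ k₂) i, -α * c.X₁ ω i + (1 - α) * ω.2.2.1 i +
            -α * ω.2.2.2 i + 0 * (c.X₂ ω i - ν i) =
            ω.2.2.1 i - α * (c.Y ω i - c.X₂ ω i) := fun ω i => by
          simp only [Y, Pi.add_apply]
          ring
        simp only [h2] at h1
        refine h1.trans_eq ?_
        have h3 : α * (1 + P₁ + Q + 2 * C) = Q + C := by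
          rw [hα, div_mul_cancel₀ _ hV₁.ne']
        -- The product `κ Q` is the least-squares error `Q - (Q + C)² / (1 + P₁ + Q + 2C)`.
        have h4 : (1 + P₁ - C ^ 2 / Q) / (1 + P₁ + Q + 2 * C) * Q * (1 + P₁ + Q + 2 * C) =
            (1 + P₁) * Q - C ^ 2 := by
          rw [mul_right_comm, div_mul_cancel₀ _ hV₁.ne', sub_mul, hCQ]
        congr 1
        refine mul_right_cancel₀ hV₁.ne' ?_
        rw [h4]
        linear_combination (α * (1 + P₁ + Q + 2 * C) - (Q + C)) * h3)
    rwa [Real.coe_toNNReal _ hV.le, Real.coe_toNNReal _ hκ.le] at h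

end DirtyMACCode

/-! ### From the correlation to a coefficient in `[-1, 0]`. -/

/-- Passing from the correlation `C` to a nonpositive correlation coefficient only relaxes the
bounds. -/
theorem exists_correlation_coefficient (P₁ P₂ Q : ℝ≥0) (C : ℝ) (hC : C ^ 2 ≤ P₁ * Q) :
    ∃ ρ ∈ Set.Icc (-1 : ℝ) 0,
      Real.log (1 + P₁ - C ^ 2 / Q) ≤ Real.log (1 + P₁ * (1 - ρ ^ 2)) ∧
      Real.log (P₂ + (1 + P₁ + Q + 2 * C)) +
          Real.log ((1 + P₁ - C ^ 2 / Q) / (1 + P₁ + Q + 2 * C)) ≤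
        Real.log (1 + P₂ / (1 + P₁ + Q + 2 * ρ * √(P₁ * Q))) +
          Real.log (1 + P₁ * (1 - ρ ^ 2)) := by
  have hQ : (0 : ℝ) ≤ Q := Q.2
  have hP₁ : (0 : ℝ) ≤ P₁ := P₁.2
  have hP₂ : (0 : ℝ) ≤ P₂ := P₂.2
  have hC'sq : (min C 0) ^ 2 ≤ C ^ 2 := by
    rcases le_total C 0 with h | h
    · rw [min_eq_left h]
    · rw [min_eq_right h]
      simpa using sq_nonneg C
  -- `ρ` is `min C 0` divided by `√(P₁ Q)`. If `P₁ Q = 0` then `C = 0`, and `ρ = 0` serves.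
  obtain ⟨ρ, hρ, h1, h2⟩ : ∃ ρ ∈ Set.Icc (-1 : ℝ) 0, ρ * √(P₁ * Q) = min C 0 ∧
      P₁ * ρ ^ 2 = (min C 0) ^ 2 / Q := by
    rcases eq_or_ne ((P₁ : ℝ) * Q) 0 with h0 | h0
    · have hC0 : C = 0 := by
        rw [h0] at hC
        simpa using hC
      exact ⟨0, by simp, by simp [hC0], by simp [hC0]⟩
    · have hpos : (0 : ℝ) < P₁ * Q := lt_of_le_of_ne (by positivity) h0.symm
      have hs := Real.sqrt_pos.2 hpos
      refine ⟨min C 0 / √(P₁ * Q), ⟨?_, ?_⟩, by field_simp, ?_⟩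
      · rw [le_div_iff₀ hs]
        have := Real.abs_le_sqrt (hC'sq.trans hC)
        linarith [neg_abs_le (min C 0)]
      · exact div_nonpos_of_nonpos_of_nonneg (min_le_right _ _) hs.le
      · rw [div_pow, Real.sq_sqrt hpos.le]
        have := left_ne_zero_of_mul h0
        have := right_ne_zero_of_mul h0
        field_simp
  have he : 0 < 1 + P₁ - C ^ 2 / Q := by
    have := div_le_of_le_mul₀ hQ hP₁ hC
    linarith
  have hee : 1 + P₁ - C ^ 2 / Q ≤ 1 + P₁ * (1 - ρ ^ 2) := by
    have := div_le_div_of_nonneg_right hC'sq hQ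
    rw [mul_sub, h2]
    linarith
  have hV' : 0 < 1 + P₁ + Q + 2 * min C 0 := by
    have h3 := Real.abs_le_sqrt (hC'sq.trans hC)
    have h4 := neg_abs_le (min C 0)
    have h5 : √((P₁ : ℝ) * Q) = √P₁ * √Q := Real.sqrt_mul hP₁ _
    have h6 := Real.sq_sqrt hP₁
    have h7 := Real.sq_sqrt hQ
    have h8 := sq_nonneg (√(P₁ : ℝ) - √Q)
    linarith
  have hVV : 1 + P₁ + Q + 2 * min C 0 ≤ 1 + P₁ + Q + 2 * C := by
    linarith [min_le_left C 0]
  have hV := hV'.trans_le hVV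
  refine ⟨ρ, hρ, Real.log_le_log he hee, ?_⟩
  rw [mul_assoc, h1, ← Real.log_mul (by linarith) (by positivity),
    ← Real.log_mul (by positivity) (by linarith)]
  refine Real.log_le_log (by positivity) ?_
  -- After this regrouping each factor can only grow when `C` becomes `min C 0`: the first because
  -- its denominator shrinks, the second because `C²` does.
  have h3 : (P₂ + (1 + P₁ + Q + 2 * C)) * ((1 + P₁ - C ^ 2 / Q) / (1 + P₁ + Q + 2 * C)) =
      (1 + P₂ / (1 + P₁ + Q + 2 * C)) * (1 + P₁ - C ^ 2 / Q) := by
    field_simp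
    ring
  rw [h3]
  refine mul_le_mul ?_ hee he.le (by positivity)
  gcongr

/-! ### Letting the blocklength grow, compactness, and the closure. -/

theorem rate_le_of_fano {b R x ε l n : ℝ} (hb : 1 < b) (hn : 0 < n) (hε : ε ≤ 1)
    (hx : n * R * Real.log b ≤ x) (h : (1 - ε) * x ≤ n / 2 * l + Real.log 2) :
    R ≤ 1 / 2 * (l / Real.log b) + (ε * R + Real.log 2 / Real.log b / n) := by
  have hlog := Real.log_pos hb
  have h1 := (mul_le_mul_of_nonneg_left hx (sub_nonneg.2 hε)).trans h
  have h2 : 1 / 2 * (l / Real.log b) + (ε * R + Real.log 2 / Real.log b / n) - R =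
      (n / 2 * l + Real.log 2 - (1 - ε) * (n * R * Real.log b)) / (n * Real.log b) := by
    field_simp
    ring
  have h3 : 0 ≤ (n / 2 * l + Real.log 2 - (1 - ε) * (n * R * Real.log b)) / (n * Real.log b) :=
    div_nonneg (by linarith) (by positivity)
  linarith

/-- One sufficiently long code gives the bounds up to `δ`, with a `ρ` that depends on `δ` through
that code. -/
theorem DirtyMACAchievable.exists_approx {b : ℝ} (hb : 1 < b) {P₁ P₂ Q : ℝ≥0} {R : ℝ × ℝ}
    (hR : DirtyMACAchievable b P₁ P₂ Q R) {δ : ℝ} (hδ : 0 < δ) :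
    ∃ ρ ∈ Set.Icc (-1 : ℝ) 0,
      R.1 ≤ 1 / 2 * Real.logb b (1 + P₁ * (1 - ρ ^ 2)) + δ ∧
      R.2 ≤ 1 / 2 * Real.logb b (1 + P₂) + δ ∧
      R.1 + R.2 ≤ 1 / 2 * Real.logb b (1 + P₂ / (1 + P₁ + Q + 2 * ρ * √(P₁ * Q))) +
        1 / 2 * Real.logb b (1 + P₁ * (1 - ρ ^ 2)) + δ := by
  obtain ⟨hR₁, hR₂, k₁, k₂, c, hc, herr⟩ := hR
  have hb0 : 0 < b := one_pos.trans hb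
  have hlogb := Real.log_pos hb
  -- The loss in the sum-rate bound also dominates those of the individual rates, since rates and
  -- error probabilities are nonnegative.
  have hlim : Tendsto (fun n : ℕ => (c n).errorProb Q * (R.1 + R.2) +
      Real.log 2 / Real.log b / (n : ℝ)) atTop (𝓝 0) := by
    simpa using (herr.mul_const (R.1 + R.2)).add
      (tendsto_const_div_atTop_nhds_zero_nat (Real.log 2 / Real.log b))
  obtain ⟨n, hnδ, hn1, hn⟩ := ((hlim.eventually_le_const hδ).and
    ((herr.eventually_le_const one_pos).and (eventually_ge_atTop 1))).exists
  obtain ⟨hk₁, hk₂, hpow⟩ := hc n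
  -- A positive lower bound on the number of messages makes the message sets nonempty, so that the
  -- channel law is a probability measure.
  have hk₁0 : (0 : ℝ) < k₁ n := (Real.rpow_pos_of_pos hb0 _).trans_le hk₁
  have hk₂0 : (0 : ℝ) < k₂ n := (Real.rpow_pos_of_pos hb0 _).trans_le hk₂
  have : NeZero n := ⟨by lia⟩
  have : NeZero (k₁ n) := ⟨by rintro h; simp [h] at hk₁0⟩
  have : NeZero (k₂ n) := ⟨by rintro h; simp [h] at hk₂0⟩
  have hn0 : (0 : ℝ) < n := by exact_mod_cast hn
  have hlog : ∀ {r x : ℝ}, b ^ ((n : ℝ) * r) ≤ x → n * r * Real.log b ≤ Real.log x :=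
    fun {r x} h => by
    rw [← Real.log_rpow hb0]
    exact Real.log_le_log (Real.rpow_pos_of_pos hb0 _) h
  have hε0 : 0 ≤ (c n).errorProb Q := measureReal_nonneg
  obtain ⟨C, hC, h1, h2, h3⟩ := (c n).exists_correlation_converse P₁ P₂ Q hpow
  obtain ⟨ρ, hρ, h4, h5⟩ := exists_correlation_coefficient P₁ P₂ Q C hC
  have hn2 : (0 : ℝ) ≤ n / 2 := by positivity
  have h1' := rate_le_of_fano hb hn0 hn1 (hlog hk₁)
    (h1.trans (add_le_add_left (mul_le_mul_of_nonneg_left h4 hn2) _))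
  have h2' := rate_le_of_fano hb hn0 hn1 (hlog hk₂) h2
  have h3' := rate_le_of_fano (R := R.1 + R.2) hb hn0 hn1
    (by linarith [hlog hk₁, hlog hk₂])
    (h3.trans (add_le_add_left (mul_le_mul_of_nonneg_left h5 hn2) _))
  rw [add_div] at h3'
  refine ⟨ρ, hρ, ?_, ?_, ?_⟩ <;> simp only [Real.logb]
  · linarith [mul_nonneg hε0 hR₂]
  · linarith [mul_nonneg hε0 hR₁]
  · linarith

/-- A cluster point in `K` of the approximate solutions as `δ` decreases to `0` satisfies all the
inequalities exactly, by continuity on `K`. -/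
theorem IsCompact.exists_le_of_forall_le_add {X ι : Type*} [TopologicalSpace X] {K : Set X}
    (hK : IsCompact K) (r : ι → ℝ) (f : ι → X → ℝ) (hf : ∀ i, ContinuousOn (f i) K)
    (h : ∀ δ > 0, ∃ x ∈ K, ∀ i, r i ≤ f i x + δ) : ∃ x ∈ K, ∀ i, r i ≤ f i x := by
  have : Nonempty X := ⟨(h 1 one_pos).choose⟩
  choose! u huK hu using h
  have hev : ∀ᶠ δ in 𝓝[>] (0 : ℝ), u δ ∈ K := eventually_mem_nhdsWithin.mono huK
  obtain ⟨x, hxK, hx⟩ := hK (f := map u (𝓝[>] (0 : ℝ))) (le_principal_iff.2 hev)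
  refine ⟨x, hxK, fun i => le_of_forall_pos_le_add fun ε hε => ?_⟩
  have hcont : ∀ᶠ y in 𝓝[K] x, f i y < f i x + ε / 2 :=
    (hf i x hxK).eventually_lt_const (by linarith)
  have hfreq : ∃ᶠ δ in 𝓝[>] (0 : ℝ), u δ ∈ {y | y ∈ K → f i y < f i x + ε / 2} :=
    mapClusterPt_iff_frequently.1 hx _ (mem_nhdsWithin_iff_eventually.1 hcont)
  have hsmall : ∀ᶠ δ in 𝓝[>] (0 : ℝ), δ < ε / 2 ∧ 0 < δ :=
    (eventually_nhdsWithin_of_eventually_nhds (eventually_lt_nhds (by linarith))).and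
      eventually_mem_nhdsWithin
  obtain ⟨δ, hδ, hδε, hδ0⟩ := (hfreq.and_eventually hsmall).exists
  have := hδ (huK δ hδ0)
  have := hu δ hδ0 i
  linarith

theorem theorem2 (b : ℝ) (hb : 1 < b) (P₁ P₂ Q : ℝ≥0) :
    dirtyMACCapacityRegion b P₁ P₂ Q ⊆
      {R : ℝ × ℝ | ∃ ρ ∈ Set.Icc (-1 : ℝ) 0,
        R.1 ≤ 1 / 2 * Real.logb b (1 + P₁ * (1 - ρ ^ 2)) ∧
        R.2 ≤ 1 / 2 * Real.logb b (1 + P₂) ∧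
        R.1 + R.2 ≤
          1 / 2 * Real.logb b (1 + P₂ / (1 + P₁ + Q + 2 * ρ * Real.sqrt (P₁ * Q))) +
            1 / 2 * Real.logb b (1 + P₁ * (1 - ρ ^ 2))} := by
  intro R hR
  have hP₁ : (0 : ℝ) ≤ P₁ := P₁.2
  have hP₂ : (0 : ℝ) ≤ P₂ := P₂.2
  have hQ : (0 : ℝ) ≤ Q := Q.2
  have he : ∀ ρ ∈ Set.Icc (-1 : ℝ) 0, (0 : ℝ) < 1 + P₁ * (1 - ρ ^ 2) := fun ρ hρ => by
    have : 0 ≤ 1 - ρ ^ 2 := by nlinarith [hρ.1, hρ.2]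
    positivity
  have hV : ∀ ρ ∈ Set.Icc (-1 : ℝ) 0, (0 : ℝ) < 1 + P₁ + Q + 2 * ρ * √(P₁ * Q) := fun ρ hρ => by
    have h1 := mul_le_mul_of_nonneg_right hρ.1 (Real.sqrt_nonneg ((P₁ : ℝ) * Q))
    have h2 : √((P₁ : ℝ) * Q) = √P₁ * √Q := Real.sqrt_mul hP₁ _
    have h3 := Real.sq_sqrt hP₁
    have h4 := Real.sq_sqrt hQ
    have h5 := sq_nonneg (√(P₁ : ℝ) - √Q)
    linarith
  have hcont₁ : ContinuousOn (fun ρ : ℝ => 1 / 2 * Real.logb b (1 + P₁ * (1 - ρ ^ 2)))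
      (Set.Icc (-1) 0) :=
    continuousOn_const.mul (ContinuousOn.div_const
      (ContinuousOn.log (by fun_prop) fun ρ hρ => (he ρ hρ).ne') _)
  have hcont₂ : ContinuousOn
      (fun ρ : ℝ => 1 / 2 * Real.logb b (1 + P₂ / (1 + P₁ + Q + 2 * ρ * √(P₁ * Q))))
      (Set.Icc (-1) 0) :=
    continuousOn_const.mul (ContinuousOn.div_const
      (ContinuousOn.log (continuousOn_const.add (continuousOn_const.div (by fun_prop)
        fun ρ hρ => (hV ρ hρ).ne')) fun ρ hρ =>
          (add_pos_of_pos_of_nonneg one_pos (div_nonneg hP₂ (hV ρ hρ).le)).ne') _)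
  obtain ⟨ρ, hρ, h⟩ := isCompact_Icc.exists_le_of_forall_le_add (K := Set.Icc (-1 : ℝ) 0)
    ![R.1, R.2, R.1 + R.2]
    ![fun ρ => 1 / 2 * Real.logb b (1 + P₁ * (1 - ρ ^ 2)),
      fun _ => 1 / 2 * Real.logb b (1 + P₂),
      fun ρ => 1 / 2 * Real.logb b (1 + P₂ / (1 + P₁ + Q + 2 * ρ * √(P₁ * Q))) +
        1 / 2 * Real.logb b (1 + P₁ * (1 - ρ ^ 2))]
    (by
      rw [Fin.forall_fin_succ, Fin.forall_fin_two]
      exact ⟨hcont₁, continuousOn_const, hcont₂.add hcont₁⟩)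
    (fun δ hδ => by
      -- Thirds, because the sum of the rates moves by up to `2δ / 3` and the approximate converse
      -- costs another `δ / 3`.
      obtain ⟨R', hR', hdist⟩ := Metric.mem_closure_iff.1 hR (δ / 3) (by positivity)
      rw [Prod.dist_eq, max_lt_iff, Real.dist_eq, Real.dist_eq, abs_lt, abs_lt] at hdist
      obtain ⟨ρ, hρ, h1, h2, h3⟩ :=
        DirtyMACAchievable.exists_approx hb hR' (δ := δ / 3) (by positivity)
      refine ⟨ρ, hρ, ?_⟩
      rw [Fin.forall_fin_succ, Fin.forall_fin_two]
      simp only [Matrix.cons_val_zero, Matrix.cons_val_succ, Matrix.cons_val_one]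
      exact ⟨by linarith, by linarith, by linarith⟩)
  rw [Fin.forall_fin_succ, Fin.forall_fin_two] at h
  exact ⟨ρ, hρ, h⟩
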